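/- Setting. Let $\alpha\in(0,1)$. For every $m\ge 2$ let $p_{1,m},\dots,p_{m,m}$ be $[0,1]$-valued random variables ($p$-values) on a probability space $(\Omega_m,\mathcal A_m,P_m)$, and let $I_{0,m}\subseteq\{1,\dots,m\}$ be a nonrandom set (the true null hypotheses) with complement $I_{1,m}$, such that $m_0:=\#I_{0,m}\ge 1$; put $m_1:=\#I_{1,m}$. Assume basic independence: the vectors $(p_{i,m})_{i\in I_{0,m}}$ and $(p_{i,m})_{i\in I_{1,m}}$ are independent, and the $p_{i,m}$, $i\in I_{0,m}$, are independent and uniformly distributed on $[0,1]$ (the dependence among the $p_{i,m}$, $i\in I_{1,m}$, is arbitrary). Assume $m_0/m\to\kappa_0\in(0,1]$ as $m\to\infty$. Let $(a_m)$, $(b_m)$ be real sequences with $b_m/m\to0$ such that for every $m$ either $b_m>0$ and $a_m\in[0,1-\alpha]$, or $b_m=0$ and $a_m\in[0,1-\alpha)$. Consider the step-up test with the deterministic critical values $$\alpha_{i:m}=\frac{i\alpha}{m+b_m-a_m i},\qquad 0\le i\le m.$$ With the ordered $p$-values $p_{1:m}\le\dots\le p_{m:m}$ and $p_{0:m}:=0$,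 let $R_m=\max\{i\in\{0,\dots,m\}:p_{i:m}\le\alpha_{i:m}\}$ be the number of rejections, $V_m=\#\{i\in I_{0,m}:p_{i,m}\le\alpha_{R_m:m}\}$ the number of false rejections, and $\mathrm{FDP}_m=V_m/R_m$ with $0/0=0$. For $j=1,2$ let $R_m^{(j,1)}$ be the number of rejections of the same test when the $p$-values of the $j$ smallest indices in $I_{0,m}$ (of all of $I_{0,m}$ if $m_0<j$) are replaced by $0$. The test is called consistent if $\mathrm{FDP}_m-E(\mathrm{FDP}_m)\to0$ in $P_m$-probability. Lemma. (a) The test is consistent if and only if the following three conditions hold in $P_m$-probability: $$R_m^{(1,1)}\to\infty,\tag{1}$$ $$\frac{a_m}{m}\Bigl(R_m^{(2,1)}-R_m^{(1,1)}\Bigr)\to0,\tag{2}$$ $$\frac{m+b_m-a_mR_m^{(1,1)}}{m_0}-E\Bigl(\frac{m+b_m-a_mR_m^{(1,1)}}{m_0}\Bigr)\to0.\tag{3}$$ (b) If $\kappa_0=1$, $m_1\to\infty$ and $\limsup_{m\to\infty}a_m<1-\alpha$, then (1) alone is sufficient for consistency, and moreover $E(\mathrm{FDP}_m)\to\alpha$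 (whether or not (1) holds). -/

import Mathlib

open MeasureTheory ProbabilityTheory Filter
open scoped Topology

namespace StepUp

/-- The ordered `p`-values `p_{1:m} ≤ … ≤ p_{m:m}`, together with `p_{0:m} = 0`
(indices `i > m`, which are never used, get the value `0`). -/
noncomputable def orderedPValue {m : ℕ} (p : Fin m → ℝ) (i : ℕ) : ℝ :=
  if h : 0 < i ∧ i ≤ m then p (Tuple.sort p ⟨i - 1, by omega⟩) else 0

/-- The number of rejections `R = max {i = 0, …, m : p_{i:m} ≤ α_{i:m}}` of the step-up test with
critical values `crit i = α_{i:m}`, where `crit 0 = 0`. -/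
noncomputable def numRejections {m : ℕ} (crit : ℕ → ℝ) (p : Fin m → ℝ) : ℕ :=
  ((Finset.range (m + 1)).filter fun i => orderedPValue p i ≤ crit i).sup id

/-- The number of false rejections `V`: hypothesis `i` is rejected iff `p_i ≤ α_{R:m}`, and the
rejection is false iff `i` is a true null hypothesis, `i ∈ I₀`. -/
noncomputable def numFalseRejections {m : ℕ} (crit : ℕ → ℝ) (I₀ : Finset (Fin m))
    (p : Fin m → ℝ) : ℕ :=
  (I₀.filter fun i => p i ≤ crit (numRejections crit p)).card

/-- The false discovery proportion `V / R`, with `0 / 0 = 0`. -/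
noncomputable def fdp {m : ℕ} (crit : ℕ → ℝ) (I₀ : Finset (Fin m)) (p : Fin m → ℝ) : ℝ :=
  (numFalseRejections crit I₀ p : ℝ) / (numRejections crit p : ℝ)

/-- The vector `p^{(j,1)}`: the `p`-values of the `j` true null hypotheses with the smallest
indices are replaced by `0` (all those of the true nulls if there are fewer than `j`). -/
noncomputable def substPValues {m : ℕ} (I₀ : Finset (Fin m)) (j : ℕ) (p : Fin m → ℝ) :
    Fin m → ℝ :=
  fun i => if i ∈ I₀ ∧ (I₀.filter fun k => k < i).card < j then 0 else p i

/-- `R^{(j,1)}`: the number of rejections for the substituted vector `p^{(j,1)}`. -/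
noncomputable def numRejectionsSubst {m : ℕ} (crit : ℕ → ℝ) (I₀ : Finset (Fin m)) (j : ℕ)
    (p : Fin m → ℝ) : ℕ :=
  numRejections crit (substPValues I₀ j p)

/-- The critical values `α_{i:m} = i α / (m + b - a i)`. -/
noncomputable def critVal (α a b : ℝ) (m i : ℕ) : ℝ :=
  (i : ℝ) * α / ((m : ℝ) + b - a * (i : ℝ))

/-- The admissible parameters: `b > 0` and `a ∈ [0, 1 - α]`, or `b = 0` and `a ∈ [0, 1 - α)`. -/
def AdmissibleParams (α a b : ℝ) : Prop :=
  (0 < b ∧ a ∈ Set.Icc 0 (1 - α)) ∨ (b = 0 ∧ a ∈ Set.Ico 0 (1 - α))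

/-- The basic independence model with `p`-values `p i` in `[0, 1]` and (nonrandom, nonempty) set
`I₀` of true null hypotheses. -/
structure BasicIndependence {Ω : Type*} [MeasurableSpace Ω] (P : Measure Ω) {m : ℕ}
    (p : Fin m → Ω → ℝ) (I₀ : Finset (Fin m)) : Prop where
  nonempty_trueNulls : I₀.Nonempty
  measurable : ∀ i, Measurable (p i)
  mem_Icc : ∀ i ω, p i ω ∈ Set.Icc (0 : ℝ) 1
  indep_true_false :
    IndepFun (fun ω (i : {i : Fin m // i ∈ I₀}) => p i ω)
      (fun ω (i : {i : Fin m // i ∉ I₀}) => p i ω) P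
  indep_true : iIndepFun (fun i : {i : Fin m // i ∈ I₀} => p i) P
  uniform_true : ∀ i ∈ I₀, ∀ x ∈ Set.Icc (0 : ℝ) 1, P {ω | p i ω ≤ x} = ENNReal.ofReal x

/-- `X_m → c` in `P_m`-probability, where `X_m` lives on its own space `(Ω_m, P_m)`. -/
def TendstoInProb {Ω : ℕ → Type*} [∀ m, MeasurableSpace (Ω m)] (P : ∀ m, Measure (Ω m))
    (X : ∀ m, Ω m → ℝ) (c : ℝ) : Prop :=
  ∀ ε : ℝ, 0 < ε → Tendsto (fun m => P m {ω | ε ≤ |X m ω - c|}) atTop (𝓝 0)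

/-- `X_m → ∞` in `P_m`-probability, where `X_m` lives on its own space `(Ω_m, P_m)`. -/
def TendstoInProbAtTop {Ω : ℕ → Type*} [∀ m, MeasurableSpace (Ω m)] (P : ∀ m, Measure (Ω m))
    (X : ∀ m, Ω m → ℝ) : Prop :=
  ∀ K : ℝ, Tendsto (fun m => P m {ω | X m ω ≤ K}) atTop (𝓝 0)

end StepUp

/-!
A rejected `p`-value can be lowered to `0` without changing the number of rejections, and for a true
null the original `p`-value is independent of the modified vector. Hence, with `q_j = m₀ c_r / r` at
`r = R^{(j,1)}`, one gets `E[FDP] = E[q₁]` and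
`E[FDP²] = E[q₁ / R^{(1,1)}] + (1 - 1 / m₀) E[q₂²]`, so that
`Var FDP = E[q₁ / R^{(1,1)}] + E[q₂² - q₁²] + Var q₁ - E[q₂²] / m₀`.
The first three terms are nonnegative and the last one vanishes in the limit. For
`c_r = r α / (m + b - a r)` the reciprocal of `q_j` is affine in `R^{(j,1)}` and `q_j` stays in a
compact subinterval of `(0, ∞)`, so the three terms tend to `0` if and only if conditions (1), (2)
and (3) hold, respectively.

For (b), all but `m₁ + j` of the `R^{(j,1)}` rejections concern true nulls with an unmodified
`p`-value, which gives `E[R^{(j,1)} / m] ≤ u E[R^{(j+1,1)} / m] + o(1)` with some `u < 1`. Iterating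
this, `R^{(j,1)} / m` tends to `0` in mean. Hence `q_j → α` in mean, and `E[q₂² - q₁²]` and `Var q₁`
tend to `0`.
-/

namespace StepUp

section Moments

variable {Ω : Type*} [MeasurableSpace Ω] {P : Measure Ω} {X Y : Ω → ℝ}

lemma memLp_two_of_forall_integrable (hX : ∀ g : ℝ → ℝ, Integrable (fun ω => g (X ω)) P) :
    MemLp X 2 P :=
  (memLp_two_iff_integrable_sq (hX id).aestronglyMeasurable).2 (hX (· ^ 2))

variable [IsProbabilityMeasure P]

lemma integral_sub_const_sq (hX : MemLp X 2 P) (t : ℝ) :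
    ∫ ω, (X ω - t) ^ 2 ∂P = Var[X; P] + (∫ ω, X ω ∂P - t) ^ 2 := by
  have hXt : MemLp (fun ω => X ω - t) 2 P := hX.sub (memLp_const t)
  have hvar := variance_eq_sub hXt
  rw [variance_sub_const hX.aestronglyMeasurable,
    integral_sub (hX.integrable one_le_two) (integrable_const t), integral_const, probReal_univ,
    one_smul] at hvar
  simp only [Pi.pow_apply] at hvar
  linarith

lemma integral_integral_sub_sq (hX : MemLp X 2 P) :
    Integrable (fun ω' => ∫ ω, (X ω - X ω') ^ 2 ∂P) P ∧
      ∫ ω', ∫ ω, (X ω - X ω') ^ 2 ∂P ∂P = 2 * Var[X; P] := by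
  have hcomm (ω' : Ω) : (∫ ω, X ω ∂P - X ω') ^ 2 = (X ω' - ∫ ω, X ω ∂P) ^ 2 := sub_sq_comm _ _
  have hint : Integrable (fun ω' => (X ω' - ∫ ω, X ω ∂P) ^ 2) P :=
    (hX.sub (memLp_const _)).integrable_sq
  simp only [integral_sub_const_sq hX, hcomm]
  refine ⟨(integrable_const _).add hint, ?_⟩
  rw [integral_add (integrable_const _) hint, integral_sub_const_sq hX, integral_const,
    probReal_univ, one_smul, sub_self]
  ring

lemma variance_le_of_abs_sub_le {L : ℝ} (hX : MemLp X 2 P) (hY : MemLp Y 2 P)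
    (hXY : ∀ ω ω', |Y ω - Y ω'| ≤ L * |X ω - X ω'|) : Var[Y; P] ≤ L ^ 2 * Var[X; P] := by
  have hsq (ω ω' : Ω) : (Y ω - Y ω') ^ 2 ≤ L ^ 2 * (X ω - X ω') ^ 2 := by
    rw [← sq_abs (Y ω - Y ω'), ← sq_abs (X ω - X ω'), ← mul_pow]
    exact pow_le_pow_left₀ (abs_nonneg _) (hXY ω ω') 2
  have hdiff {Z : Ω → ℝ} (hZ : MemLp Z 2 P) (ω' : Ω) : Integrable (fun ω => (Z ω - Z ω') ^ 2) P :=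
    (hZ.sub (memLp_const (Z ω'))).integrable_sq
  have hmono : ∫ ω', ∫ ω, (Y ω - Y ω') ^ 2 ∂P ∂P ≤
      ∫ ω', L ^ 2 * ∫ ω, (X ω - X ω') ^ 2 ∂P ∂P := by
    refine integral_mono (integral_integral_sub_sq hY).1
      ((integral_integral_sub_sq hX).1.const_mul _) fun ω' => ?_
    rw [← integral_const_mul]
    exact integral_mono (hdiff hY ω') ((hdiff hX ω').const_mul _) fun ω => hsq ω ω'
  rw [integral_const_mul, (integral_integral_sub_sq hX).2, (integral_integral_sub_sq hY).2] at hmono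
  linarith

lemma integral_le_add_mul_measureReal {C ε : ℝ} (hX : Measurable X)
    (hXC : ∀ ω, X ω ∈ Set.Icc 0 C) (hε : 0 ≤ ε) :
    ∫ ω, X ω ∂P ≤ ε + C * P.real {ω | ε ≤ X ω} := by
  have hs : MeasurableSet {ω | ε ≤ X ω} := measurableSet_le measurable_const hX
  have hconst : Integrable ({ω | ε ≤ X ω}.indicator fun _ => C) P :=
    (integrable_const C).indicator hs
  have hint : Integrable X P := Integrable.of_bound hX.aestronglyMeasurable C
    (ae_of_all _ fun ω => (Real.norm_of_nonneg (hXC ω).1).trans_le (hXC ω).2)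
  calc ∫ ω, X ω ∂P ≤ ∫ ω, (ε + {ω | ε ≤ X ω}.indicator (fun _ => C) ω) ∂P := by
        refine integral_mono hint ((integrable_const ε).add hconst) fun ω => ?_
        by_cases hω : ω ∈ {ω | ε ≤ X ω}
        · simpa only [Set.indicator_of_mem hω] using le_add_of_nonneg_of_le hε (hXC ω).2
        · simpa only [Set.indicator_of_notMem hω, add_zero] using (not_le.1 hω).le
    _ = ε + C * P.real {ω | ε ≤ X ω} := by
        rw [integral_add (integrable_const ε) hconst, integral_indicator hs, setIntegral_const,
          integral_const, probReal_univ, one_smul, smul_eq_mul, mul_comm C]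

end Moments

section RealSequences

variable {ι : Type*} {F : Filter ι}

lemma tendsto_zero_iff_of_le_of_le {f g : ι → ℝ} {k K : ℝ} (hk : 0 < k)
    (hf : ∀ᶠ i in F, 0 ≤ f i) (hlow : ∀ᶠ i in F, k * f i ≤ g i) (hup : ∀ᶠ i in F, g i ≤ K * f i) :
    Tendsto g F (𝓝 0) ↔ Tendsto f F (𝓝 0) := by
  refine ⟨fun h => squeeze_zero' hf ?_ (by simpa using h.div_const k),
    fun h => squeeze_zero' ?_ hup (by simpa using h.const_mul K)⟩
  · filter_upwards [hlow] with i hi using (le_div_iff₀' hk).2 hi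
  · filter_upwards [hf, hlow] with i hi hi' using (mul_nonneg hk.le hi).trans hi'

lemma tendsto_add_zero_iff_of_nonneg {f g : ι → ℝ}
    (hf : ∀ᶠ i in F, 0 ≤ f i) (hg : ∀ᶠ i in F, 0 ≤ g i) :
    Tendsto (fun i => f i + g i) F (𝓝 0) ↔ Tendsto f F (𝓝 0) ∧ Tendsto g F (𝓝 0) := by
  refine ⟨fun h => ⟨squeeze_zero' hf ?_ h, squeeze_zero' hg ?_ h⟩,
    fun h => by simpa using h.1.add h.2⟩
  · filter_upwards [hg] with i hi using le_add_of_nonneg_right hi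
  · filter_upwards [hf] with i hi using le_add_of_nonneg_left hi

/-- After `k` steps of the recursion the limit superior of `x j` is at most `u ^ k`. -/
lemma tendsto_zero_of_le_mul_succ_add {x e : ℕ → ℕ → ℝ} {u : ℝ} (hu0 : 0 ≤ u) (hu1 : u < 1)
    (hx0 : ∀ j, ∀ᶠ m in atTop, 0 ≤ x j m) (hx1 : ∀ j, ∀ᶠ m in atTop, x j m ≤ 1)
    (he : ∀ j, Tendsto (e j) atTop (𝓝 0))
    (hx : ∀ j, ∀ᶠ m in atTop, x j m ≤ u * x (j + 1) m + e j m) (j : ℕ) :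
    Tendsto (x j) atTop (𝓝 0) := by
  have hiter (k : ℕ) : ∀ j, ∀ ε > 0, ∀ᶠ m in atTop, x j m ≤ u ^ k + ε := by
    induction k with
    | zero =>
      intro j ε hε
      filter_upwards [hx1 j] with m hm
      rw [pow_zero]
      linarith
    | succ k ih =>
      intro j ε hε
      filter_upwards [hx j, ih (j + 1) (ε / 2) (half_pos hε),
        (he j).eventually_lt_const (half_pos hε)] with m hrec hk hem
      have : u * x (j + 1) m ≤ u * (u ^ k + ε / 2) := mul_le_mul_of_nonneg_left hk hu0
      have : u * (ε / 2) ≤ ε / 2 := mul_le_of_le_one_left (half_pos hε).le hu1.le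
      rw [pow_succ']
      linarith
  refine tendsto_order.2 ⟨fun y hy => (hx0 j).mono fun _ => hy.trans_le, fun ε hε => ?_⟩
  obtain ⟨k, hk⟩ := exists_pow_lt_of_lt_one (half_pos hε) hu1
  filter_upwards [hiter k j (ε / 2) (half_pos hε)] with m hm
  linarith

end RealSequences

section Convergence

variable {Ω : ℕ → Type*} [∀ m, MeasurableSpace (Ω m)] {P : ∀ m, Measure (Ω m)}
  {X : ∀ m, Ω m → ℝ}

lemma tendstoInProb_zero_iff_sq :
    TendstoInProb P X 0 ↔ TendstoInProb P (fun m ω => X m ω ^ 2) 0 := by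
  simp only [TendstoInProb, sub_zero, abs_of_nonneg (sq_nonneg (X _ _))]
  refine ⟨fun h ε hε => ?_, fun h ε hε => ?_⟩
  · simpa only [Real.sqrt_le_left (abs_nonneg _), sq_abs] using h (√ε) (Real.sqrt_pos.2 hε)
  · simpa only [sq_le_sq, abs_of_pos hε] using h (ε ^ 2) (pow_pos hε 2)

variable [∀ m, IsProbabilityMeasure (P m)] {C : ℝ}

lemma tendsto_measure_zero_iff_measureReal {s : ∀ m, Set (Ω m)} :
    Tendsto (fun m => P m (s m)) atTop (𝓝 0) ↔
      Tendsto (fun m => (P m).real (s m)) atTop (𝓝 0) :=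
  (ENNReal.tendsto_toReal_iff (fun m => measure_ne_top (P m) (s m)) ENNReal.zero_ne_top).symm

lemma tendstoInProb_zero_iff_integral
    (hX : ∀ᶠ m in atTop, Measurable (X m) ∧ ∀ ω, X m ω ∈ Set.Icc 0 C) :
    TendstoInProb P X 0 ↔ Tendsto (fun m => ∫ ω, X m ω ∂P m) atTop (𝓝 0) := by
  have habs : ∀ᶠ m in atTop, ∀ ε, {ω | ε ≤ |X m ω|} = {ω | ε ≤ X m ω} := by
    filter_upwards [hX] with m hm ε
    simp only [abs_of_nonneg (hm.2 _).1]
  have hnonneg : ∀ᶠ m in atTop, 0 ≤ ∫ ω, X m ω ∂P m :=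
    hX.mono fun m hm => integral_nonneg fun ω => (hm.2 ω).1
  simp only [TendstoInProb, sub_zero, tendsto_measure_zero_iff_measureReal]
  constructor
  · intro h
    refine tendsto_order.2 ⟨fun y hy => hnonneg.mono fun _ => hy.trans_le, fun ε hε => ?_⟩
    have hlim := ((h (ε / 2) (half_pos hε)).const_mul C).const_add (ε / 2)
    rw [mul_zero, add_zero] at hlim
    filter_upwards [hX, habs, hlim.eventually_lt_const (half_lt_self hε)] with m hm hset hlt
    rw [hset] at hlt
    exact (integral_le_add_mul_measureReal hm.1 hm.2 (half_pos hε).le).trans_lt hlt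
  · intro h ε hε
    refine squeeze_zero' (Eventually.of_forall fun m => measureReal_nonneg) ?_
      (by simpa using h.div_const ε)
    filter_upwards [hX, habs] with m hm hset
    have hint : Integrable (X m) (P m) := Integrable.of_bound hm.1.aestronglyMeasurable C
      (ae_of_all _ fun ω => (Real.norm_of_nonneg (hm.2 ω).1).trans_le (hm.2 ω).2)
    rw [hset, le_div_iff₀' hε]
    exact mul_meas_ge_le_integral_of_nonneg (ae_of_all _ fun ω => (hm.2 ω).1) hint ε

lemma tendstoInProb_sub_integral_iff_variance
    (hX : ∀ᶠ m in atTop, Measurable (X m) ∧ ∀ ω, X m ω ∈ Set.Icc 0 C) :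
    TendstoInProb P (fun m ω => X m ω - ∫ ω', X m ω' ∂P m) 0 ↔
      Tendsto (fun m => Var[X m; P m]) atTop (𝓝 0) := by
  rw [tendstoInProb_zero_iff_sq, tendstoInProb_zero_iff_integral (C := C ^ 2)]
  · refine tendsto_congr' ?_
    filter_upwards [hX] with m hm
    rw [variance_eq_integral hm.1.aemeasurable]
  · filter_upwards [hX] with m hm
    have hmean : ∫ ω, X m ω ∂P m ∈ Set.Icc 0 C := by
      refine ⟨integral_nonneg fun ω => (hm.2 ω).1, ?_⟩
      simpa using integral_mono_of_nonneg (ae_of_all (P m) fun ω => (hm.2 ω).1)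
        (integrable_const C) (ae_of_all _ fun ω => (hm.2 ω).2)
    refine ⟨(hm.1.sub_const _).pow_const 2, fun ω => ⟨sq_nonneg _, sq_le_sq' ?_ ?_⟩⟩
    all_goals linarith [(hm.2 ω).1, (hm.2 ω).2, hmean.1, hmean.2]

lemma tendstoInProbAtTop_iff_integral_inv {N : ∀ m, Ω m → ℕ}
    (hN : ∀ᶠ m in atTop, Measurable (N m) ∧ ∀ ω, 0 < N m ω) :
    TendstoInProbAtTop P (fun m ω => (N m ω : ℝ)) ↔
      Tendsto (fun m => ∫ ω, (N m ω : ℝ)⁻¹ ∂P m) atTop (𝓝 0) := by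
  rw [← tendstoInProb_zero_iff_integral (C := 1)]
  swap
  · filter_upwards [hN] with m hm
    exact ⟨(Measurable.of_discrete (f := fun n : ℕ => (n : ℝ)⁻¹)).comp hm.1,
      fun ω => ⟨by positivity, Nat.cast_inv_le_one _⟩⟩
  have hset (K : ℝ) (hK : 0 < K) : ∀ᶠ m in atTop,
      {ω | (N m ω : ℝ) ≤ K} = {ω | K⁻¹ ≤ |(N m ω : ℝ)⁻¹|} := by
    filter_upwards [hN] with m hm
    ext ω
    have hω : (0 : ℝ) < N m ω := Nat.cast_pos.2 (hm.2 ω)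
    simp only [Set.mem_ofPred_eq, abs_of_pos (inv_pos.2 hω), inv_le_inv₀ hK hω]
  simp only [TendstoInProbAtTop, TendstoInProb, sub_zero]
  refine ⟨fun h ε hε => ?_, fun h K => ?_⟩
  · refine (h ε⁻¹).congr' ?_
    filter_upwards [hset ε⁻¹ (inv_pos.2 hε)] with m hm
    rw [hm, inv_inv]
  · have hK : 0 < max K 1 := lt_max_of_lt_right one_pos
    refine tendsto_of_tendsto_of_tendsto_of_le_of_le' tendsto_const_nhds
      (h (max K 1)⁻¹ (inv_pos.2 hK)) (Eventually.of_forall fun _ => zero_le) ?_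
    filter_upwards [hset (max K 1) hK] with m hm
    rw [← hm]
    exact measure_mono fun ω hω => hω.trans (le_max_left K 1)

end Convergence

section Independence

variable {Ω E E₁ E₂ E₃ ι : Type*} [MeasurableSpace Ω] [MeasurableSpace E] [MeasurableSpace E₁]
  [MeasurableSpace E₂] [MeasurableSpace E₃] {P : Measure Ω}

lemma indepFun_update_of_iIndepFun [Finite ι] [DecidableEq ι] {X : ι → Ω → E}
    (hX : ∀ k, Measurable (X k)) (h : iIndepFun X P) (i : ι) (x₀ : E) :
    IndepFun (X i) (fun ω => Function.update (fun k => X k ω) i x₀) P := by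
  have := Fintype.ofFinite ι
  let others : Finset ι := Finset.univ.erase i
  let extend (x : others → E) (k : ι) : E := if hk : k = i then x₀ else x ⟨k, by simp [others, hk]⟩
  have hextend : Measurable extend := measurable_pi_lambda _ fun k => by
    by_cases hk : k = i
    · simp [extend, hk]
    · simpa [extend, hk] using measurable_pi_apply _
  have hi : Measurable fun x : ({i} : Finset ι) → E => x ⟨i, by simp⟩ := measurable_pi_apply _
  convert (h.indepFun_finset {i} others (by simp [others]) hX).comp hi hextend using 1
  · rfl
  funext ω k
  by_cases hk : k = i <;> simp [extend, hk]

variable [IsFiniteMeasure P]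

lemma integral_ite_le_of_indepFun {A : Ω → ℝ} {W : Ω → E} (hA : Measurable A)
    (hW : Measurable W) (hAW : IndepFun A W P)
    (hunif : ∀ x ∈ Set.Icc (0 : ℝ) 1, P {ω | A ω ≤ x} = ENNReal.ofReal x)
    {f g : E → ℝ} (hf : Measurable f) (hf01 : ∀ w, f w ∈ Set.Icc (0 : ℝ) 1)
    (hg : Measurable g) (hgW : Integrable (g ∘ W) P) :
    ∫ ω, (if A ω ≤ f (W ω) then g (W ω) else 0) ∂P = ∫ ω, f (W ω) * g (W ω) ∂P := by
  have hle : MeasurableSet {z : ℝ × E | z.1 ≤ f z.2} :=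
    measurableSet_le measurable_fst (hf.comp measurable_snd)
  have hprod := (indepFun_iff_map_prod_eq_prod_map_map hA.aemeasurable hW.aemeasurable).1 hAW
  have hgmap : Integrable g (P.map W) :=
    (integrable_map_measure hg.aestronglyMeasurable hW.aemeasurable).2 hgW
  have hslice (w : E) : ∫ a, (if a ≤ f w then g w else 0) ∂(P.map A) = f w * g w := by
    have hcdf : (P.map A).real (Set.Iic (f w)) = f w := by
      rw [map_measureReal_apply hA measurableSet_Iic, measureReal_def]
      exact (congrArg _ (hunif _ (hf01 w))).trans (ENNReal.toReal_ofReal (hf01 w).1)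
    exact (integral_indicator_const (g w) measurableSet_Iic).trans (by rw [hcdf, smul_eq_mul])
  calc ∫ ω, (if A ω ≤ f (W ω) then g (W ω) else 0) ∂P
      = ∫ z, (if z.1 ≤ f z.2 then g z.2 else 0) ∂(P.map fun ω => (A ω, W ω)) := by
        rw [integral_map (hA.prodMk hW).aemeasurable]
        exact (Measurable.ite hle (hg.comp measurable_snd) measurable_const).aestronglyMeasurable
    _ = ∫ w, ∫ a, (if a ≤ f w then g w else 0) ∂(P.map A) ∂(P.map W) := by
        rw [hprod, integral_prod_symm]
        exact (hgmap.comp_snd _).indicator hle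
    _ = ∫ w, f w * g w ∂(P.map W) := integral_congr_ae (ae_of_all _ hslice)
    _ = ∫ ω, f (W ω) * g (W ω) ∂P :=
        integral_map hW.aemeasurable (hf.mul hg).aestronglyMeasurable

lemma integrable_comp_of_mem_finset [Countable E] [MeasurableSingletonClass E] {N : Ω → E}
    (hN : Measurable N) {s : Finset E} (hs : ∀ ω, N ω ∈ s) (g : E → ℝ) :
    Integrable (fun ω => g (N ω)) P :=
  .of_bound (Measurable.of_discrete.comp hN).aestronglyMeasurable (∑ x ∈ s, |g x|) <|
    ae_of_all _ fun ω =>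
      Finset.single_le_sum (f := fun x => |g x|) (fun _ _ => abs_nonneg _) (hs ω)

lemma indepFun_prodMk_of_indepFun {A : Ω → E₁} {B : Ω → E₂} {Y : Ω → E₃} (hA : Measurable A)
    (hB : Measurable B) (hY : Measurable Y) (hAB : IndepFun A B P)
    (hABY : IndepFun (fun ω => (A ω, B ω)) Y P) : IndepFun A (fun ω => (B ω, Y ω)) P := by
  have hBY : IndepFun B Y P := hABY.comp measurable_snd measurable_id
  rw [indepFun_iff_map_prod_eq_prod_map_map hA.aemeasurable (hB.prodMk hY).aemeasurable,
    (indepFun_iff_map_prod_eq_prod_map_map hB.aemeasurable hY.aemeasurable).1 hBY]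
  calc P.map (fun ω => (A ω, (B ω, Y ω)))
      = (P.map (fun ω => ((A ω, B ω), Y ω))).map MeasurableEquiv.prodAssoc := by
        rw [Measure.map_map MeasurableEquiv.prodAssoc.measurable ((hA.prodMk hB).prodMk hY)]
        rfl
    _ = (P.map A).prod ((P.map B).prod (P.map Y)) := by
        rw [(indepFun_iff_map_prod_eq_prod_map_map (hA.prodMk hB).aemeasurable
            hY.aemeasurable).1 hABY,
          (indepFun_iff_map_prod_eq_prod_map_map hA.aemeasurable hB.aemeasurable).1 hAB]
        exact Measure.prodAssoc_prod

end Independence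

section Deterministic

variable {m : ℕ} {c : ℕ → ℝ} {p q : Fin m → ℝ}

/-- The number of `p`-values that are at most `t`, i.e. `m` times their empirical distribution
function. -/
noncomputable def countLE (p : Fin m → ℝ) (t : ℝ) : ℕ :=
  (Finset.univ.filter fun k => p k ≤ t).card

/-- Critical values `0 = c 0 ≤ c 1 ≤ … ≤ c m ≤ 1` of a step-up test for `m` hypotheses. -/
structure IsCritical (m : ℕ) (c : ℕ → ℝ) : Prop where
  zero : c 0 = 0
  mono : ∀ i j, i ≤ j → j ≤ m → c i ≤ c j
  le_one : c m ≤ 1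

lemma IsCritical.mem_Icc (hc : IsCritical m c) {i : ℕ} (hi : i ≤ m) : c i ∈ Set.Icc (0 : ℝ) 1 :=
  ⟨hc.zero ▸ hc.mono 0 i i.zero_le hi, (hc.mono i m hi le_rfl).trans hc.le_one⟩

lemma countLE_comp_perm (p : Fin m → ℝ) (σ : Equiv.Perm (Fin m)) (t : ℝ) :
    countLE (p ∘ σ) t = countLE p t :=
  Finset.card_equiv σ fun k => by simp

lemma countLE_anti (h : q ≤ p) (t : ℝ) : countLE p t ≤ countLE q t :=
  Finset.card_le_card <| Finset.monotone_filter_right _ fun k _ hk => (h k).trans hk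

lemma orderedPValue_le_iff (p : Fin m → ℝ) {i : ℕ} (hi : 0 < i) (him : i ≤ m) (t : ℝ) :
    orderedPValue p i ≤ t ↔ i ≤ countLE p t := by
  have h := Tuple.lt_card_le_iff_apply_le_of_monotone (j := (⟨i - 1, by omega⟩ : Fin m))
    (a := t) (Tuple.monotone_sort p)
  rw [← countLE_comp_perm p (Tuple.sort p) t, orderedPValue, dif_pos ⟨hi, him⟩, countLE]
  simp only [Function.comp_apply] at h ⊢
  rw [← h]
  omega

lemma isGreatest_numRejections (hc : c 0 = 0) (p : Fin m → ℝ) :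
    IsGreatest {i | i ≤ m ∧ i ≤ countLE p (c i)} (numRejections c p) := by
  have h0 : orderedPValue p 0 ≤ c 0 := by simp [orderedPValue, hc]
  have hset : ({i | i ≤ m ∧ i ≤ countLE p (c i)} : Set ℕ) =
      (Finset.range (m + 1)).filter fun i => orderedPValue p i ≤ c i := by
    ext i
    rcases Nat.eq_zero_or_pos i with rfl | hi
    · simp [h0]
    · simp only [Finset.coe_filter, Finset.mem_range, Nat.lt_succ_iff, Set.mem_ofPred_eq]
      exact and_congr_right fun him => (orderedPValue_le_iff p hi him _).symm
  have hne : ((Finset.range (m + 1)).filter fun i => orderedPValue p i ≤ c i).Nonempty :=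
    ⟨0, by simp [h0]⟩
  rw [hset, numRejections, ← Finset.sup'_eq_sup hne, ← Finset.max'_eq_sup']
  exact Finset.isGreatest_max' _ hne

lemma numRejections_le (hc : c 0 = 0) (p : Fin m → ℝ) : numRejections c p ≤ m :=
  (isGreatest_numRejections hc p).1.1

lemma le_numRejections_iff (hc : c 0 = 0) {n : ℕ} :
    n ≤ numRejections c p ↔ ∃ i, n ≤ i ∧ i ≤ m ∧ i ≤ countLE p (c i) :=
  ⟨fun h => ⟨_, h, (isGreatest_numRejections hc p).1⟩,
    fun ⟨_, hn, hi⟩ => hn.trans ((isGreatest_numRejections hc p).2 hi)⟩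

lemma IsCritical.apply_numRejections_mem_Icc (hc : IsCritical m c) (p : Fin m → ℝ) :
    c (numRejections c p) ∈ Set.Icc (0 : ℝ) 1 :=
  hc.mem_Icc (numRejections_le hc.zero p)

lemma countLE_apply_numRejections (hc : IsCritical m c) (p : Fin m → ℝ) :
    countLE p (c (numRejections c p)) = numRejections c p := by
  refine le_antisymm ?_ (isGreatest_numRejections hc.zero p).1.2
  set n := countLE p (c (numRejections c p))
  have hnm : n ≤ m := (Finset.card_le_univ _).trans_eq (Fintype.card_fin m)
  by_contra! h
  refine h.not_ge ((isGreatest_numRejections hc.zero p).2 ⟨hnm, Finset.card_le_card ?_⟩)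
  exact Finset.monotone_filter_right _ fun k _ hk => hk.trans (hc.mono _ _ h.le hnm)

lemma numRejections_comp_perm (hc : c 0 = 0) (p : Fin m → ℝ) (σ : Equiv.Perm (Fin m)) :
    numRejections c (p ∘ σ) = numRejections c p := by
  have h := isGreatest_numRejections hc (p ∘ σ)
  simp only [countLE_comp_perm] at h
  exact h.unique (isGreatest_numRejections hc p)

lemma numRejections_anti (hc : c 0 = 0) (h : q ≤ p) : numRejections c p ≤ numRejections c q :=
  let ⟨hm, hR⟩ := (isGreatest_numRejections hc p).1
  (isGreatest_numRejections hc q).2 ⟨hm, hR.trans (countLE_anti h _)⟩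

lemma measurable_countLE (t : ℝ) : Measurable fun p : Fin m → ℝ => countLE p t := by
  simp only [countLE, Finset.card_filter]
  exact Finset.measurable_sum _ fun k _ =>
    Measurable.ite (measurableSet_le (measurable_pi_apply k) measurable_const)
      measurable_const measurable_const

lemma measurable_numRejections (hc : c 0 = 0) :
    Measurable fun p : Fin m → ℝ => numRejections c p := by
  refine measurable_of_Ici fun n => ?_
  simp only [Set.preimage, Set.mem_Ici, le_numRejections_iff hc, Set.ofPred_exists]
  refine .iUnion fun i => .inter (.const _) (.inter (.const _) ?_)
  exact measurableSet_le measurable_const (measurable_countLE _)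

/-- The vector of `p`-values in which those with index in `T` are replaced by `0`. -/
noncomputable def zeroOn (T : Finset (Fin m)) (p : Fin m → ℝ) : Fin m → ℝ :=
  fun i => if i ∈ T then 0 else p i

lemma zeroOn_empty (p : Fin m → ℝ) : zeroOn ∅ p = p := by
  ext; simp [zeroOn]

lemma zeroOn_zeroOn (S T : Finset (Fin m)) (p : Fin m → ℝ) :
    zeroOn S (zeroOn T p) = zeroOn (S ∪ T) p := by
  ext i
  simp only [zeroOn, Finset.mem_union]
  split_ifs <;> tauto

lemma zeroOn_anti (hp : 0 ≤ p) {S T : Finset (Fin m)} (h : S ⊆ T) : zeroOn T p ≤ zeroOn S p := by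
  intro i
  have hi : 0 ≤ p i := hp i
  have hST := @h i
  simp only [zeroOn]
  split_ifs <;> tauto

lemma measurable_zeroOn (T : Finset (Fin m)) : Measurable (zeroOn T) := by
  refine measurable_pi_lambda _ fun i => ?_
  unfold zeroOn
  split_ifs
  exacts [measurable_const, measurable_pi_apply i]

lemma numRejections_zeroOn_mono (hc : c 0 = 0) (hp : 0 ≤ p) {S T : Finset (Fin m)} (h : S ⊆ T) :
    numRejections c (zeroOn S p) ≤ numRejections c (zeroOn T p) :=
  numRejections_anti hc (zeroOn_anti hp h)

lemma numRejections_zeroOn_pos (hc : IsCritical m c) (p : Fin m → ℝ) {T : Finset (Fin m)}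
    (hT : T.Nonempty) : 0 < numRejections c (zeroOn T p) := by
  obtain ⟨i, hi⟩ := hT
  refine (isGreatest_numRejections hc.zero _).2 ⟨i.pos, Finset.card_pos.2 ⟨i, ?_⟩⟩
  simp [zeroOn, hi, (hc.mem_Icc i.pos).1]

/-- If `p i` is at most the threshold reached after lowering it to `0`, then the same `p`-values lie
below that threshold before and after, so the threshold was already attainable before. -/
lemma numRejections_zeroOn_insert (hc : IsCritical m c) (hp : 0 ≤ p) {T : Finset (Fin m)}
    {i : Fin m} (h : p i ≤ c (numRejections c (zeroOn (insert i T) p))) :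
    numRejections c (zeroOn (insert i T) p) = numRejections c (zeroOn T p) := by
  refine le_antisymm ?_ (numRejections_zeroOn_mono hc.zero hp (Finset.subset_insert i T))
  obtain ⟨hm, hR⟩ := (isGreatest_numRejections hc.zero (zeroOn (insert i T) p)).1
  refine (isGreatest_numRejections hc.zero _).2 ⟨hm, hR.trans ?_⟩
  refine Finset.card_le_card (Finset.monotone_filter_right _ fun k _ hk => ?_)
  have hc0 := (hc.mem_Icc hm).1
  simp only [zeroOn, Finset.mem_insert] at hk ⊢
  grind

lemma le_crit_zeroOn_insert_iff (hc : IsCritical m c) (hp : 0 ≤ p) {T : Finset (Fin m)}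
    {i : Fin m} :
    p i ≤ c (numRejections c (zeroOn (insert i T) p)) ↔
      p i ≤ c (numRejections c (zeroOn T p)) := by
  refine ⟨fun h => numRejections_zeroOn_insert hc hp h ▸ h, fun h => h.trans ?_⟩
  exact hc.mono _ _ (numRejections_zeroOn_mono hc.zero hp (Finset.subset_insert i T))
    (numRejections_le hc.zero _)

lemma measurable_ite_forall_le (hc : c 0 = 0) (S T : Finset (Fin m)) (g : ℕ → ℝ) :
    Measurable fun x : Fin m → ℝ => if ∀ i ∈ S, x i ≤ c (numRejections c (zeroOn T x)) then
      g (numRejections c (zeroOn T x)) else 0 := by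
  have hN : Measurable fun x : Fin m → ℝ => numRejections c (zeroOn T x) :=
    (measurable_numRejections hc).comp (measurable_zeroOn T)
  refine .ite ?_ (Measurable.of_discrete.comp hN) measurable_const
  simp only [Set.ofPred_forall]
  exact .biInter S.countable_toSet fun i _ =>
    measurableSet_le (measurable_pi_apply i) (Measurable.of_discrete.comp hN)

/-- The `j` smallest elements of `I₀` (all of `I₀` if it has fewer), i.e. the indices of the
`p`-values that `substPValues I₀ j` replaces by `0`. -/
noncomputable def firstNulls (I₀ : Finset (Fin m)) (j : ℕ) : Finset (Fin m) :=
  I₀.filter fun i => (I₀.filter fun k => k < i).card < j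

lemma substPValues_eq_zeroOn (I₀ : Finset (Fin m)) (j : ℕ) (p : Fin m → ℝ) :
    substPValues I₀ j p = zeroOn (firstNulls I₀ j) p := by
  ext i
  simp [substPValues, zeroOn, firstNulls]

lemma firstNulls_subset (I₀ : Finset (Fin m)) (j : ℕ) : firstNulls I₀ j ⊆ I₀ :=
  Finset.filter_subset _ _

lemma firstNulls_mono (I₀ : Finset (Fin m)) : Monotone (firstNulls I₀) := fun _ _ h =>
  Finset.monotone_filter_right _ fun _ _ hi => hi.trans_le h

lemma firstNulls_map_univ {n : ℕ} (e : Fin n ↪o Fin m) (j : ℕ) :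
    firstNulls (Finset.univ.map e.toEmbedding) j =
      (Finset.univ.filter fun l : Fin n => (l : ℕ) < j).map e.toEmbedding := by
  have hrank (l : Fin n) : ((Finset.univ.map e.toEmbedding).filter fun k => k < e l).card = l := by
    rw [Finset.filter_map, Finset.card_map]
    simp only [Function.comp_def, RelEmbedding.coe_toEmbedding, OrderEmbedding.lt_iff_lt,
      Finset.filter_gt_eq_Iio, Fin.card_Iio]
  rw [firstNulls, Finset.filter_map]
  simp only [Function.comp_def, RelEmbedding.coe_toEmbedding, hrank]

lemma card_firstNulls (I₀ : Finset (Fin m)) (j : ℕ) :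
    (firstNulls I₀ j).card = min I₀.card j := by
  conv_lhs => rw [← Finset.map_orderEmbOfFin_univ I₀ rfl]
  rw [firstNulls_map_univ, Finset.card_map, Fin.card_filter_val_lt]

end Deterministic

section Counts

variable {Ω : Type*} {m : ℕ} {c : ℕ → ℝ} {p : Fin m → Ω → ℝ}

/-- The number of rejections when the `p`-values with index in `T` are replaced by `0`. -/
noncomputable def rejCount (c : ℕ → ℝ) (p : Fin m → Ω → ℝ) (T : Finset (Fin m)) (ω : Ω) : ℕ :=
  numRejections c (zeroOn T fun i => p i ω)

/-- The number of true null hypotheses outside `T` that are rejected when the `p`-values with index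
in `T` are replaced by `0`; for `T = ∅` these are the false rejections. -/
noncomputable def falseRejCount (c : ℕ → ℝ) (p : Fin m → Ω → ℝ) (I₀ T : Finset (Fin m)) (ω : Ω) :
    ℕ :=
  ((I₀ \ T).filter fun i => p i ω ≤ c (rejCount c p T ω)).card

lemma IsCritical.apply_rejCount_mem_Icc (hc : IsCritical m c) (T : Finset (Fin m)) (ω : Ω) :
    c (rejCount c p T ω) ∈ Set.Icc (0 : ℝ) 1 :=
  hc.apply_numRejections_mem_Icc _

lemma falseRejCount_empty_le_rejCount (hc : IsCritical m c) (I₀ : Finset (Fin m)) (ω : Ω) :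
    falseRejCount c p I₀ ∅ ω ≤ rejCount c p ∅ ω := by
  rw [rejCount, ← countLE_apply_numRejections hc, falseRejCount, rejCount, zeroOn_empty, countLE]
  exact Finset.card_le_card (Finset.filter_subset_filter _ (Finset.subset_univ _))

lemma rejCount_le_falseRejCount_add (hc : c 0 = 0) (I₀ T : Finset (Fin m)) (ω : Ω) :
    rejCount c p T ω ≤ falseRejCount c p I₀ T ω + (I₀ᶜ.card + T.card) := by
  rw [add_comm I₀ᶜ.card, ← add_assoc]
  refine (isGreatest_numRejections hc _).1.2.trans ?_
  refine le_trans (Finset.card_le_card fun k hk => ?_)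
    ((Finset.card_union_le (_ ∪ T) _).trans (Nat.add_le_add_right (Finset.card_union_le _ _) _))
  by_cases hkT : k ∈ T
  · simp [hkT]
  · simp only [Finset.mem_filter, Finset.mem_univ, true_and, zeroOn, hkT, if_false] at hk
    have hkR : p k ω ≤ c (rejCount c p T ω) := hk
    by_cases hkI : k ∈ I₀ <;> simp [hkI, hkT, hkR]

/-- `R^{(j,1)}` as a random variable. -/
noncomputable def substCount (c : ℕ → ℝ) (p : Fin m → Ω → ℝ) (I₀ : Finset (Fin m)) (j : ℕ) (ω : Ω) :
    ℕ :=
  rejCount c p (firstNulls I₀ j) ω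

/-- The ratio `m₀ c_r / r` at `r = R^{(j,1)}`: among `r` rejections at the threshold `c_r`, it is
the proportion of false ones that one expects. -/
noncomputable def nominalFDP (c : ℕ → ℝ) (p : Fin m → Ω → ℝ) (I₀ : Finset (Fin m)) (j : ℕ) (ω : Ω) :
    ℝ :=
  I₀.card * c (substCount c p I₀ j ω) / substCount c p I₀ j ω

lemma numRejectionsSubst_eq_substCount (c : ℕ → ℝ) (I₀ : Finset (Fin m)) (j : ℕ) (ω : Ω) :
    numRejectionsSubst c I₀ j (fun i => p i ω) = substCount c p I₀ j ω := by
  rw [numRejectionsSubst, substPValues_eq_zeroOn, substCount, rejCount]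

lemma fdp_eq_falseRejCount_div (c : ℕ → ℝ) (I₀ : Finset (Fin m)) (ω : Ω) :
    fdp c I₀ (fun i => p i ω) = falseRejCount c p I₀ ∅ ω / rejCount c p ∅ ω := by
  simp only [fdp, numFalseRejections, falseRejCount, rejCount, zeroOn_empty, Finset.sdiff_empty]

lemma IsCritical.fdp_mem_Icc (hc : IsCritical m c) (I₀ : Finset (Fin m)) (ω : Ω) :
    fdp c I₀ (fun i => p i ω) ∈ Set.Icc (0 : ℝ) 1 := by
  rw [fdp_eq_falseRejCount_div]
  exact ⟨by positivity, div_le_one_of_le₀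
    (Nat.cast_le.2 (falseRejCount_empty_le_rejCount hc I₀ ω)) (Nat.cast_nonneg _)⟩

end Counts

section BasicIndependence

variable {Ω : Type*} [MeasurableSpace Ω] {P : Measure Ω} {m : ℕ} {c : ℕ → ℝ} {p : Fin m → Ω → ℝ}
  {I₀ : Finset (Fin m)}

lemma BasicIndependence.measurable_vec (h : BasicIndependence P p I₀) :
    Measurable fun ω i => p i ω :=
  measurable_pi_lambda _ h.measurable

lemma BasicIndependence.vec_nonneg (h : BasicIndependence P p I₀) (ω : Ω) :
    0 ≤ fun i => p i ω := fun i => (h.mem_Icc i ω).1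

lemma BasicIndependence.measurable_rejCount (h : BasicIndependence P p I₀) (hc : c 0 = 0)
    (T : Finset (Fin m)) : Measurable (rejCount c p T) :=
  (measurable_numRejections hc).comp ((measurable_zeroOn T).comp h.measurable_vec)

lemma BasicIndependence.measurable_falseRejCount (h : BasicIndependence P p I₀) (hc : c 0 = 0)
    (T : Finset (Fin m)) : Measurable (falseRejCount c p I₀ T) := by
  unfold falseRejCount
  simp only [Finset.card_filter]
  exact Finset.measurable_sum _ fun k _ => Measurable.ite
    (measurableSet_le (h.measurable k) (Measurable.of_discrete.comp (h.measurable_rejCount hc T)))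
    measurable_const measurable_const

lemma BasicIndependence.measurable_substCount (h : BasicIndependence P p I₀) (hc : c 0 = 0)
    (j : ℕ) : Measurable (substCount c p I₀ j) :=
  h.measurable_rejCount hc _

lemma BasicIndependence.measurable_fdp (h : BasicIndependence P p I₀) (hc : c 0 = 0) :
    Measurable fun ω => fdp c I₀ fun i => p i ω := by
  simp only [fdp_eq_falseRejCount_div]
  exact (Measurable.of_discrete.comp (h.measurable_falseRejCount hc ∅)).div
    (Measurable.of_discrete.comp (h.measurable_rejCount hc ∅))

lemma BasicIndependence.substCount_pos (h : BasicIndependence P p I₀) (hc : IsCritical m c) {j : ℕ}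
    (hj : 0 < j) (ω : Ω) : 0 < substCount c p I₀ j ω := by
  refine numRejections_zeroOn_pos hc _ (Finset.card_pos.1 ?_)
  rw [card_firstNulls]
  exact lt_min (Finset.card_pos.2 h.nonempty_trueNulls) hj

lemma BasicIndependence.monotone_substCount (h : BasicIndependence P p I₀) (hc : c 0 = 0) (ω : Ω) :
    Monotone fun j => substCount c p I₀ j ω := fun _ _ hij =>
  numRejections_zeroOn_mono hc (h.vec_nonneg ω) (firstNulls_mono I₀ hij)

variable [IsProbabilityMeasure P]

lemma BasicIndependence.indepFun_zeroOn (h : BasicIndependence P p I₀) {i : Fin m}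
    (hi : i ∈ I₀) : IndepFun (p i) (fun ω => zeroOn {i} fun k => p k ω) P := by
  let i₀ : {k // k ∈ I₀} := ⟨i, hi⟩
  have hupdate : Measurable fun x : {k // k ∈ I₀} → ℝ => Function.update x i₀ 0 :=
    measurable_update_left
  have htrue : Measurable fun ω (k : {k // k ∈ I₀}) => p k ω :=
    measurable_pi_lambda _ fun k => h.measurable k
  have hfalse : Measurable fun ω (k : {k // k ∉ I₀}) => p k ω :=
    measurable_pi_lambda _ fun k => h.measurable k
  have hindep := indepFun_prodMk_of_indepFun (h.measurable i) (hupdate.comp htrue) hfalse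
    (indepFun_update_of_iIndepFun (fun k : {k // k ∈ I₀} => h.measurable k) h.indep_true i₀ 0)
    (h.indep_true_false.comp ((measurable_pi_apply i₀).prodMk hupdate) measurable_id)
  have hmerge : Measurable (MeasurableEquiv.piEquivPiSubtypeProd (fun _ => ℝ) (· ∈ I₀)).symm :=
    MeasurableEquiv.measurable _
  convert hindep.comp measurable_id hmerge using 1
  · rfl
  funext ω k
  by_cases hk : k ∈ I₀
  · by_cases hki : k = i
    · subst hki
      simp [zeroOn, i₀, hk, MeasurableEquiv.piEquivPiSubtypeProd, Equiv.piEquivPiSubtypeProd]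
    · simp [zeroOn, i₀, hk, hki, MeasurableEquiv.piEquivPiSubtypeProd, Equiv.piEquivPiSubtypeProd]
  · have hki : k ≠ i := fun h => hk (h ▸ hi)
    simp [zeroOn, hk, hki, MeasurableEquiv.piEquivPiSubtypeProd, Equiv.piEquivPiSubtypeProd]

lemma BasicIndependence.identDistrib_true (h : BasicIndependence P p I₀) {i k : Fin m}
    (hi : i ∈ I₀) (hk : k ∈ I₀) : IdentDistrib (p i) (p k) P P := by
  refine ⟨(h.measurable i).aemeasurable, (h.measurable k).aemeasurable, ?_⟩
  have : IsProbabilityMeasure (P.map (p i)) :=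
    Measure.isProbabilityMeasure_map (h.measurable i).aemeasurable
  refine Measure.ext_of_Iic _ _ fun x => ?_
  have hcdf {l : Fin m} (hl : l ∈ I₀) : P.map (p l) (Set.Iic x) = ENNReal.ofReal (min x 1) := by
    rw [Measure.map_apply (h.measurable l) measurableSet_Iic]
    rcases lt_or_ge x 0 with hx | hx
    · have hempty : p l ⁻¹' Set.Iic x = ∅ :=
        Set.eq_empty_of_forall_notMem fun ω hω => (hω.trans_lt hx).not_ge (h.mem_Icc l ω).1
      rw [hempty, measure_empty, ENNReal.ofReal_of_nonpos ((min_le_left x 1).trans hx.le)]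
    · rw [← h.uniform_true l hl _ ⟨le_min hx zero_le_one, min_le_right x 1⟩]
      congr 1
      ext ω
      exact (le_min_iff.trans (and_iff_left (h.mem_Icc l ω).2)).symm
  rw [hcdf hi, hcdf hk]

lemma BasicIndependence.identDistrib_ofSubtype (h : BasicIndependence P p I₀)
    (τ : Equiv.Perm {i // i ∈ I₀}) :
    IdentDistrib (fun ω i => p (Equiv.Perm.ofSubtype τ i) ω) (fun ω i => p i ω) P P := by
  have htrue : IdentDistrib (fun ω (i : {i // i ∈ I₀}) => p (τ i) ω)
      (fun ω (i : {i // i ∈ I₀}) => p i ω) P P :=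
    .pi (fun i => h.identDistrib_true (τ i).2 i.2) (h.indep_true.precomp τ.injective) h.indep_true
  have hfalse : IdentDistrib (fun ω (i : {i // i ∉ I₀}) => p i ω)
      (fun ω (i : {i // i ∉ I₀}) => p i ω) P P :=
    .refl (measurable_pi_lambda _ fun i : {i // i ∉ I₀} => h.measurable i).aemeasurable
  have hindep : IndepFun (fun ω (i : {i // i ∈ I₀}) => p (τ i) ω)
      (fun ω (i : {i // i ∉ I₀}) => p i ω) P :=
    h.indep_true_false.comp (φ := fun x i => x (τ i))
      (measurable_pi_lambda _ fun i => measurable_pi_apply _) measurable_id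
  have hmerge : Measurable (MeasurableEquiv.piEquivPiSubtypeProd (fun _ => ℝ) (· ∈ I₀)).symm :=
    MeasurableEquiv.measurable _
  convert (htrue.prodMk hfalse hindep h.indep_true_false).comp hmerge using 1
  all_goals
    funext ω i
    by_cases hi : i ∈ I₀ <;>
      simp [MeasurableEquiv.piEquivPiSubtypeProd, Equiv.piEquivPiSubtypeProd, hi,
        Equiv.Perm.ofSubtype_apply_of_mem, Equiv.Perm.ofSubtype_apply_of_not_mem]

lemma BasicIndependence.integrable_falseRejCount_rejCount (h : BasicIndependence P p I₀)
    (hc : c 0 = 0) (T : Finset (Fin m)) (g : ℕ × ℕ → ℝ) :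
    Integrable (fun ω => g (falseRejCount c p I₀ T ω, rejCount c p T ω)) P := by
  refine integrable_comp_of_mem_finset
    ((h.measurable_falseRejCount hc T).prodMk (h.measurable_rejCount hc T))
    (s := Finset.Iic (m, m)) (fun ω => Finset.mem_Iic.2 ⟨?_, numRejections_le hc _⟩) g
  exact (Finset.card_le_univ _).trans_eq (Fintype.card_fin m)

lemma BasicIndependence.integrable_rejCount (h : BasicIndependence P p I₀) (hc : c 0 = 0)
    (T : Finset (Fin m)) (g : ℕ → ℝ) : Integrable (fun ω => g (rejCount c p T ω)) P :=
  h.integrable_falseRejCount_rejCount hc T fun x => g x.2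

lemma BasicIndependence.integral_rejCount_eq_of_card_eq (h : BasicIndependence P p I₀)
    (hc : c 0 = 0) {S T : Finset (Fin m)} (hS : S ⊆ I₀) (hT : T ⊆ I₀) (hST : S.card = T.card)
    (g : ℕ → ℝ) : ∫ ω, g (rejCount c p S ω) ∂P = ∫ ω, g (rejCount c p T ω) ∂P := by
  have hcard : (S.subtype (· ∈ I₀)).card = (T.subtype (· ∈ I₀)).card := by
    rw [Finset.card_subtype, Finset.card_subtype, Finset.filter_true_of_mem fun _ h => hS h,
      Finset.filter_true_of_mem fun _ h => hT h, hST]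
  let σ : Equiv.Perm (Fin m) := Equiv.Perm.ofSubtype (Finset.equivOfCardEq hcard).extendSubtype
  have hσ (i : Fin m) : i ∈ S ↔ σ i ∈ T := by
    by_cases hi : i ∈ I₀
    · by_cases hiS : i ∈ S
      · have hmem := (Finset.equivOfCardEq hcard).extendSubtype_mem ⟨i, hi⟩ (by simpa using hiS)
        simpa [σ, Equiv.Perm.ofSubtype_apply_of_mem _ hi, hiS] using hmem
      · have hmem := (Finset.equivOfCardEq hcard).extendSubtype_not_mem ⟨i, hi⟩ (by simpa using hiS)
        simpa [σ, Equiv.Perm.ofSubtype_apply_of_mem _ hi, hiS] using hmem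
    · rw [show σ i = i from Equiv.Perm.ofSubtype_apply_of_not_mem _ hi]
      exact iff_of_false (fun h => hi (hS h)) fun h => hi (hT h)
  have hperm (ω : Ω) : rejCount c (fun i => p (σ i)) S ω = rejCount c p T ω := by
    refine Eq.trans ?_ (numRejections_comp_perm hc (zeroOn T fun i => p i ω) σ)
    rw [rejCount]
    congr 1
    ext i
    simp only [zeroOn, hσ, Function.comp_apply]
  have hg : Measurable fun x : Fin m → ℝ => g (numRejections c (zeroOn S x)) :=
    Measurable.of_discrete.comp ((measurable_numRejections hc).comp (measurable_zeroOn S))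
  calc ∫ ω, g (rejCount c p S ω) ∂P
      = ∫ ω, g (rejCount c (fun i => p (σ i)) S ω) ∂P :=
        (((h.identDistrib_ofSubtype _).comp hg).integral_eq).symm
    _ = ∫ ω, g (rejCount c p T ω) ∂P := by simp only [hperm]

lemma BasicIndependence.integrable_ite_forall_le (h : BasicIndependence P p I₀) (hc : c 0 = 0)
    (S T : Finset (Fin m)) (g : ℕ → ℝ) : Integrable (fun ω =>
      if ∀ i ∈ S, p i ω ≤ c (rejCount c p T ω) then g (rejCount c p T ω) else 0) P := by
  refine (h.integrable_rejCount hc T g).mono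
    ((measurable_ite_forall_le hc S T g).comp h.measurable_vec).aestronglyMeasurable
    (ae_of_all _ fun ω => ?_)
  split_ifs
  · exact le_rfl
  · simp

/-- Each true null in `S` that is rejected may be replaced by `0` without changing the number of
rejections, after which its `p`-value is integrated out. -/
lemma BasicIndependence.integral_ite_forall_le (h : BasicIndependence P p I₀)
    (hc : IsCritical m c) {S : Finset (Fin m)} (hS : S ⊆ I₀) (T : Finset (Fin m)) (g : ℕ → ℝ) :
    ∫ ω, (if ∀ i ∈ S, p i ω ≤ c (rejCount c p T ω) then g (rejCount c p T ω) else 0) ∂P =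
      ∫ ω, c (rejCount c p (S ∪ T) ω) ^ S.card * g (rejCount c p (S ∪ T) ω) ∂P := by
  induction S using Finset.induction_on generalizing T g with
  | empty => simp
  | insert i S hiS ih =>
    obtain ⟨hi, hS⟩ := Finset.insert_subset_iff.1 hS
    let R (ω : Ω) : ℕ := rejCount c p (insert i T) ω
    have hzero (ω : Ω) : numRejections c (zeroOn T (zeroOn {i} fun k => p k ω)) = R ω := by
      simp only [R, zeroOn_zeroOn, rejCount, Finset.union_comm T, ← Finset.insert_eq]
    have hleft (ω : Ω) : (∀ k ∈ S, zeroOn {i} (fun k => p k ω) k ≤ c (R ω)) ↔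
        ∀ k ∈ S, p k ω ≤ c (R ω) :=
      forall₂_congr fun k hk => by simp [zeroOn, ne_of_mem_of_not_mem hk hiS]
    have hreplace (ω : Ω) :
        (if ∀ k ∈ insert i S, p k ω ≤ c (rejCount c p T ω) then g (rejCount c p T ω) else 0) =
          if p i ω ≤ c (R ω) then (if ∀ k ∈ S, p k ω ≤ c (R ω) then g (R ω) else 0) else 0 := by
      have hiff : p i ω ≤ c (R ω) ↔ p i ω ≤ c (rejCount c p T ω) :=
        le_crit_zeroOn_insert_iff hc (h.vec_nonneg ω)
      by_cases hpi : p i ω ≤ c (R ω)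
      · have hR : R ω = rejCount c p T ω := numRejections_zeroOn_insert hc (h.vec_nonneg ω) hpi
        have hpi' := hiff.1 hpi
        simp only [Finset.forall_mem_insert, hR, hpi', true_and, if_true]
      · simp only [Finset.forall_mem_insert, ← hiff, hpi, false_and, if_false]
    have hout := integral_ite_le_of_indepFun (h.measurable i)
      ((measurable_zeroOn {i}).comp h.measurable_vec) (h.indepFun_zeroOn hi) (h.uniform_true i hi)
      (f := fun x => c (numRejections c (zeroOn T x)))
      (Measurable.of_discrete.comp ((measurable_numRejections hc.zero).comp (measurable_zeroOn T)))
      (fun x => hc.apply_numRejections_mem_Icc _) (measurable_ite_forall_le hc.zero S T g) (by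
        simp only [Function.comp_def, hzero, hleft]
        exact h.integrable_ite_forall_le hc.zero S (insert i T) g)
    simp only [Function.comp_def, hzero, hleft] at hout
    simp only [hreplace, hout, mul_ite, mul_zero]
    rw [ih hS (insert i T) fun r => c r * g r, Finset.card_insert_of_notMem hiS,
      Finset.union_insert, ← Finset.insert_union]
    simp only [pow_succ, mul_assoc]

/-- Factorial moments of the number of false rejections, obtained by summing
`integral_ite_forall_le` over the sets `S` of `k` rejected true nulls. -/
lemma BasicIndependence.integral_choose_falseRejCount (h : BasicIndependence P p I₀)
    (hc : IsCritical m c) {T T' : Finset (Fin m)} {k : ℕ} (hT : T ⊆ I₀) (hT' : T' ⊆ I₀)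
    (hcard : T'.card = T.card + k) (g : ℕ → ℝ) :
    ∫ ω, ((falseRejCount c p I₀ T ω).choose k : ℝ) * g (rejCount c p T ω) ∂P =
      (I₀.card - T.card).choose k *
        ∫ ω, c (rejCount c p T' ω) ^ k * g (rejCount c p T' ω) ∂P := by
  have hsum (ω : Ω) : ((falseRejCount c p I₀ T ω).choose k : ℝ) * g (rejCount c p T ω) =
      ∑ S ∈ (I₀ \ T).powersetCard k,
        if ∀ i ∈ S, p i ω ≤ c (rejCount c p T ω) then g (rejCount c p T ω) else 0 := by
    have hfilter : ((I₀ \ T).powersetCard k).filter (fun S => ∀ i ∈ S, p i ω ≤ c (rejCount c p T ω))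
        = ((I₀ \ T).filter fun i => p i ω ≤ c (rejCount c p T ω)).powersetCard k := by
      ext S
      simp only [Finset.mem_filter, Finset.mem_powersetCard, Finset.subset_iff]
      grind
    rw [← Finset.sum_filter, hfilter, Finset.sum_const, Finset.card_powersetCard, nsmul_eq_mul,
      falseRejCount]
  have hterm : ∀ S ∈ (I₀ \ T).powersetCard k,
      ∫ ω, (if ∀ i ∈ S, p i ω ≤ c (rejCount c p T ω) then g (rejCount c p T ω) else 0) ∂P =
        ∫ ω, c (rejCount c p T' ω) ^ k * g (rejCount c p T' ω) ∂P := by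
    intro S hS
    obtain ⟨hsub, rfl⟩ := Finset.mem_powersetCard.1 hS
    obtain ⟨hSI, hST⟩ := Finset.subset_sdiff.1 hsub
    rw [h.integral_ite_forall_le hc hSI]
    refine h.integral_rejCount_eq_of_card_eq hc.zero (Finset.union_subset hSI hT) hT' ?_
      fun r => c r ^ S.card * g r
    rw [Finset.card_union_of_disjoint hST, hcard, add_comm]
  simp only [hsum]
  rw [integral_finsetSum _ fun S _ => h.integrable_ite_forall_le hc.zero S T g,
    Finset.sum_congr rfl hterm, Finset.sum_const, Finset.card_powersetCard,
    Finset.card_sdiff_of_subset hT, nsmul_eq_mul]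

lemma BasicIndependence.integrable_substCount (h : BasicIndependence P p I₀) (hc : c 0 = 0) (j : ℕ)
    (g : ℕ → ℝ) : Integrable (fun ω => g (substCount c p I₀ j ω)) P :=
  h.integrable_rejCount hc _ g

lemma BasicIndependence.integrable_nominalFDP (h : BasicIndependence P p I₀) (hc : c 0 = 0) (j : ℕ)
    (g : ℝ → ℝ) : Integrable (fun ω => g (nominalFDP c p I₀ j ω)) P :=
  h.integrable_substCount hc j fun r => g (I₀.card * c r / r)

lemma BasicIndependence.integrable_fdp (h : BasicIndependence P p I₀) (hc : c 0 = 0)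
    (g : ℝ → ℝ) : Integrable (fun ω => g (fdp c I₀ fun i => p i ω)) P := by
  simp only [fdp_eq_falseRejCount_div]
  exact h.integrable_falseRejCount_rejCount hc ∅ fun x => g (x.1 / x.2)

lemma BasicIndependence.integral_fdp (h : BasicIndependence P p I₀) (hc : IsCritical m c) :
    ∫ ω, fdp c I₀ (fun i => p i ω) ∂P = ∫ ω, nominalFDP c p I₀ 1 ω ∂P := by
  have hcard : (firstNulls I₀ 1).card = (∅ : Finset (Fin m)).card + 1 := by
    rw [card_firstNulls, min_eq_right (Finset.card_pos.2 h.nonempty_trueNulls), Finset.card_empty]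
  have hmoment := h.integral_choose_falseRejCount hc (Finset.empty_subset I₀)
    (firstNulls_subset I₀ 1) hcard fun r => (r : ℝ)⁻¹
  simp only [Nat.choose_one_right, pow_one, Finset.card_empty, Nat.sub_zero] at hmoment
  simp only [fdp_eq_falseRejCount_div, hmoment, ← integral_const_mul, nominalFDP, substCount,
    div_eq_mul_inv, mul_assoc]

lemma BasicIndependence.integral_fdp_sq (h : BasicIndependence P p I₀) (hc : IsCritical m c)
    (h2 : 2 ≤ I₀.card) :
    ∫ ω, fdp c I₀ (fun i => p i ω) ^ 2 ∂P =
      ∫ ω, nominalFDP c p I₀ 1 ω / substCount c p I₀ 1 ω ∂P +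
        (1 - (I₀.card : ℝ)⁻¹) * ∫ ω, nominalFDP c p I₀ 2 ω ^ 2 ∂P := by
  have hmoment {k : ℕ} (hk : k ≤ I₀.card) := h.integral_choose_falseRejCount hc
    (Finset.empty_subset I₀) (firstNulls_subset I₀ k)
    (by rw [card_firstNulls, min_eq_right hk, Finset.card_empty, zero_add])
    fun r => (r : ℝ)⁻¹ ^ 2
  have hsq (ω : Ω) : fdp c I₀ (fun i => p i ω) ^ 2 =
      (falseRejCount c p I₀ ∅ ω).choose 1 * (rejCount c p ∅ ω : ℝ)⁻¹ ^ 2 +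
        2 * ((falseRejCount c p I₀ ∅ ω).choose 2 * (rejCount c p ∅ ω : ℝ)⁻¹ ^ 2) := by
    rw [fdp_eq_falseRejCount_div, Nat.choose_one_right, Nat.cast_choose_two]
    ring
  have hint (k : ℕ) : Integrable (fun ω =>
      ((falseRejCount c p I₀ ∅ ω).choose k : ℝ) * (rejCount c p ∅ ω : ℝ)⁻¹ ^ 2) P :=
    h.integrable_falseRejCount_rejCount hc.zero ∅ fun x => x.1.choose k * (x.2 : ℝ)⁻¹ ^ 2
  simp only [hsq]
  rw [integral_add (hint 1) ((hint 2).const_mul 2), integral_const_mul, hmoment h2,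
    hmoment (one_le_two.trans h2), Finset.card_empty, Nat.sub_zero, Nat.choose_one_right,
    Nat.cast_choose_two]
  simp only [← integral_const_mul, nominalFDP, substCount]
  congr 2
  all_goals
    funext ω
    have : (I₀.card : ℝ) ≠ 0 := by positivity
    field_simp

lemma BasicIndependence.variance_fdp (h : BasicIndependence P p I₀) (hc : IsCritical m c)
    (h2 : 2 ≤ I₀.card) :
    Var[fun ω => fdp c I₀ (fun i => p i ω); P] =
      ∫ ω, nominalFDP c p I₀ 1 ω / substCount c p I₀ 1 ω ∂P +
      ∫ ω, (nominalFDP c p I₀ 2 ω ^ 2 - nominalFDP c p I₀ 1 ω ^ 2) ∂P +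
      Var[nominalFDP c p I₀ 1; P] - (I₀.card : ℝ)⁻¹ * ∫ ω, nominalFDP c p I₀ 2 ω ^ 2 ∂P := by
  have hvar {X : Ω → ℝ} (hX : ∀ g : ℝ → ℝ, Integrable (fun ω => g (X ω)) P) :
      Var[X; P] = ∫ ω, X ω ^ 2 ∂P - (∫ ω, X ω ∂P) ^ 2 :=
    variance_eq_sub (memLp_two_of_forall_integrable hX)
  rw [hvar (h.integrable_fdp hc.zero), hvar (h.integrable_nominalFDP hc.zero 1), h.integral_fdp hc,
    h.integral_fdp_sq hc h2, integral_sub (h.integrable_nominalFDP hc.zero 2 (· ^ 2))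
      (h.integrable_nominalFDP hc.zero 1 (· ^ 2))]
  ring

end BasicIndependence

section RegularTest

/-- A step-up test in the basic independence model whose critical values `c_r` are such that
`c_r / r` is nondecreasing and `m₀ c_r / r` stays in `[l, u]` for some `l > 0`. For the critical
values `r α / (m + b - a r)` the latter ratio is `α` divided by `(m + b - a r) / m₀`. -/
structure IsRegularTest {Ω : Type*} [MeasurableSpace Ω] (P : Measure Ω) {m : ℕ}
    (p : Fin m → Ω → ℝ) (I₀ : Finset (Fin m)) (c : ℕ → ℝ) (l u : ℝ) : Prop
    extends BasicIndependence P p I₀, IsCritical m c where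
  two_le_card : 2 ≤ I₀.card
  lower_pos : 0 < l
  ratio_mem_Icc : ∀ r, 0 < r → r ≤ m → I₀.card * c r / r ∈ Set.Icc l u
  ratio_mono : ∀ r s, 0 < r → r ≤ s → s ≤ m → c r / r ≤ c s / s

variable {Ω : Type*} [MeasurableSpace Ω] {P : Measure Ω} {m : ℕ} {c : ℕ → ℝ} {p : Fin m → Ω → ℝ}
  {I₀ : Finset (Fin m)} {l u : ℝ} {j : ℕ}

lemma card_nulls_le (I₀ : Finset (Fin m)) : I₀.card ≤ m :=
  I₀.card_le_univ.trans_eq (Fintype.card_fin m)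

lemma IsRegularTest.card_pos (h : IsRegularTest P p I₀ c l u) : (0 : ℝ) < I₀.card :=
  Nat.cast_pos.2 (two_pos.trans_le h.two_le_card)

lemma IsRegularTest.pos (h : IsRegularTest P p I₀ c l u) : (0 : ℝ) < m :=
  h.card_pos.trans_le (Nat.cast_le.2 (card_nulls_le I₀))

lemma IsRegularTest.upper_pos (h : IsRegularTest P p I₀ c l u) : 0 < u :=
  let hm := h.ratio_mem_Icc m (Nat.cast_pos.1 h.pos) le_rfl
  h.lower_pos.trans_le (hm.1.trans hm.2)

lemma IsRegularTest.le_card_div (h : IsRegularTest P p I₀ c l u) : l ≤ I₀.card / m := by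
  refine (h.ratio_mem_Icc m (Nat.cast_pos.1 h.pos) le_rfl).1.trans ?_
  gcongr
  exact mul_le_of_le_one_right (Nat.cast_nonneg _) h.le_one

lemma card_nulls_div_le_one (I₀ : Finset (Fin m)) : (I₀.card / m : ℝ) ≤ 1 :=
  div_le_one_of_le₀ (Nat.cast_le.2 (card_nulls_le I₀)) (Nat.cast_nonneg _)

lemma IsRegularTest.nominalFDP_mem_Icc (h : IsRegularTest P p I₀ c l u) (hj : 0 < j) (ω : Ω) :
    nominalFDP c p I₀ j ω ∈ Set.Icc l u :=
  h.ratio_mem_Icc _ (h.substCount_pos h.toIsCritical hj ω) (numRejections_le h.zero _)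

lemma IsRegularTest.nominalFDP_pos (h : IsRegularTest P p I₀ c l u) (hj : 0 < j) (ω : Ω) :
    0 < nominalFDP c p I₀ j ω :=
  h.lower_pos.trans_le (h.nominalFDP_mem_Icc hj ω).1

lemma IsRegularTest.nominalFDP_one_le_two (h : IsRegularTest P p I₀ c l u) (ω : Ω) :
    nominalFDP c p I₀ 1 ω ≤ nominalFDP c p I₀ 2 ω := by
  simp only [nominalFDP, mul_div_assoc]
  exact mul_le_mul_of_nonneg_left (h.ratio_mono _ _ (h.substCount_pos h.toIsCritical one_pos ω)
    (h.monotone_substCount h.zero ω one_le_two) (numRejections_le h.zero _)) (Nat.cast_nonneg _)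

lemma IsRegularTest.nominalFDP_sq_sub_nonneg (h : IsRegularTest P p I₀ c l u) (ω : Ω) :
    0 ≤ nominalFDP c p I₀ 2 ω ^ 2 - nominalFDP c p I₀ 1 ω ^ 2 :=
  sub_nonneg.2 (pow_le_pow_left₀ (h.nominalFDP_pos one_pos ω).le (h.nominalFDP_one_le_two ω) 2)

lemma IsRegularTest.apply_substCount_le (h : IsRegularTest P p I₀ c l u) (hj : 0 < j) (ω : Ω) :
    I₀.card * c (substCount c p I₀ j ω) ≤ u * substCount c p I₀ j ω :=
  (div_le_iff₀ (Nat.cast_pos.2 (h.substCount_pos h.toIsCritical hj ω))).1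
    (h.nominalFDP_mem_Icc hj ω).2

variable [IsProbabilityMeasure P]

lemma IsRegularTest.integral_nominalFDP_sq_le (h : IsRegularTest P p I₀ c l u) (hj : 0 < j) :
    ∫ ω, nominalFDP c p I₀ j ω ^ 2 ∂P ≤ u ^ 2 := by
  simpa using integral_mono (h.integrable_nominalFDP h.zero j (· ^ 2)) (integrable_const (u ^ 2))
    fun ω => pow_le_pow_left₀ (h.nominalFDP_pos hj ω).le (h.nominalFDP_mem_Icc hj ω).2 2

lemma IsRegularTest.integrable_nominalFDP_sq_sub (h : IsRegularTest P p I₀ c l u) :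
    Integrable (fun ω => nominalFDP c p I₀ 2 ω ^ 2 - nominalFDP c p I₀ 1 ω ^ 2) P :=
  (h.integrable_nominalFDP h.zero 2 (· ^ 2)).sub (h.integrable_nominalFDP h.zero 1 (· ^ 2))

lemma IsRegularTest.integral_nominalFDP_div_substCount_bounds (h : IsRegularTest P p I₀ c l u) :
    l * ∫ ω, (substCount c p I₀ 1 ω : ℝ)⁻¹ ∂P ≤
        ∫ ω, nominalFDP c p I₀ 1 ω / substCount c p I₀ 1 ω ∂P ∧
      ∫ ω, nominalFDP c p I₀ 1 ω / substCount c p I₀ 1 ω ∂P ≤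
        u * ∫ ω, (substCount c p I₀ 1 ω : ℝ)⁻¹ ∂P := by
  have hinv (t : ℝ) : Integrable (fun ω => t * (substCount c p I₀ 1 ω : ℝ)⁻¹) P :=
    h.integrable_substCount h.zero 1 fun r => t * (r : ℝ)⁻¹
  have hdiv : Integrable (fun ω => nominalFDP c p I₀ 1 ω / substCount c p I₀ 1 ω) P :=
    h.integrable_substCount h.zero 1 fun r => I₀.card * c r / r / r
  have hnonneg (ω : Ω) : 0 ≤ (substCount c p I₀ 1 ω : ℝ)⁻¹ := by positivity
  rw [← integral_const_mul, ← integral_const_mul]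
  exact ⟨integral_mono (hinv l) hdiv fun ω =>
      mul_le_mul_of_nonneg_right (h.nominalFDP_mem_Icc one_pos ω).1 (hnonneg ω),
    integral_mono hdiv (hinv u) fun ω =>
      mul_le_mul_of_nonneg_right (h.nominalFDP_mem_Icc one_pos ω).2 (hnonneg ω)⟩

lemma IsRegularTest.abs_integral_fdp_sub_le (h : IsRegularTest P p I₀ c l u) (β : ℝ) :
    |∫ ω, fdp c I₀ (fun i => p i ω) ∂P - β| ≤ ∫ ω, |nominalFDP c p I₀ 1 ω - β| ∂P := by
  have hsub := integral_sub (h.integrable_nominalFDP h.zero 1 id) (integrable_const (μ := P) β)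
  rw [integral_const, probReal_univ, one_smul] at hsub
  rw [h.integral_fdp h.toIsCritical]
  exact hsub ▸ abs_integral_le_integral_abs

lemma IsRegularTest.variance_nominalFDP_le (h : IsRegularTest P p I₀ c l u) (hj : 0 < j) (β : ℝ) :
    Var[nominalFDP c p I₀ j; P] ≤ (u + |β|) * ∫ ω, |nominalFDP c p I₀ j ω - β| ∂P := by
  have hint := h.integrable_nominalFDP h.zero j
  have hsq := integral_sub_const_sq (memLp_two_of_forall_integrable hint) β
  have hpt (ω : Ω) : (nominalFDP c p I₀ j ω - β) ^ 2 ≤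
      (u + |β|) * |nominalFDP c p I₀ j ω - β| := by
    rw [← sq_abs, sq]
    refine mul_le_mul_of_nonneg_right ((abs_sub _ _).trans ?_) (abs_nonneg _)
    rw [abs_of_pos (h.nominalFDP_pos hj ω)]
    exact add_le_add_left (h.nominalFDP_mem_Icc hj ω).2 _
  have hmono := integral_mono (hint fun x => (x - β) ^ 2)
    ((hint fun x => |x - β|).const_mul (u + |β|)) hpt
  rw [integral_const_mul] at hmono
  linarith [sq_nonneg (∫ ω, nominalFDP c p I₀ j ω ∂P - β)]

lemma IsRegularTest.integral_nominalFDP_sq_sub_le (h : IsRegularTest P p I₀ c l u) (β : ℝ) :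
    ∫ ω, (nominalFDP c p I₀ 2 ω ^ 2 - nominalFDP c p I₀ 1 ω ^ 2) ∂P ≤
      2 * u * (∫ ω, |nominalFDP c p I₀ 2 ω - β| ∂P + ∫ ω, |nominalFDP c p I₀ 1 ω - β| ∂P) := by
  have hint (j : ℕ) := h.integrable_nominalFDP h.zero j fun x => |x - β|
  have hpt (ω : Ω) : nominalFDP c p I₀ 2 ω ^ 2 - nominalFDP c p I₀ 1 ω ^ 2 ≤
      2 * u * (|nominalFDP c p I₀ 2 ω - β| + |nominalFDP c p I₀ 1 ω - β|) := by
    have hle := h.nominalFDP_one_le_two ω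
    have hup (j : ℕ) (hj : 0 < j) := (h.nominalFDP_mem_Icc hj ω).2
    rw [sq_sub_sq]
    refine mul_le_mul (by linarith [hup 1 one_pos, hup 2 two_pos]) ?_ (sub_nonneg.2 hle)
      (by linarith [h.upper_pos])
    linarith [le_abs_self (nominalFDP c p I₀ 2 ω - β), neg_abs_le (nominalFDP c p I₀ 1 ω - β)]
  refine (integral_mono h.integrable_nominalFDP_sq_sub
    (((hint 2).add (hint 1)).const_mul _) hpt).trans_eq ?_
  rw [integral_const_mul, integral_add' (hint 2) (hint 1)]

/-- Since `R ≤ V + m₁ + j`, this is the first moment identity for the number `V` of false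
rejections. -/
lemma IsRegularTest.integral_substCount_div_le (h : IsRegularTest P p I₀ c l u)
    (hj : j < I₀.card) :
    ∫ ω, (substCount c p I₀ j ω / m : ℝ) ∂P ≤
      u * ∫ ω, (substCount c p I₀ (j + 1) ω / m : ℝ) ∂P + (I₀ᶜ.card + j) / m := by
  have hcard {i : ℕ} (hi : i ≤ I₀.card) : (firstNulls I₀ i).card = i := by
    rw [card_firstNulls, min_eq_right hi]
  have hmoment : ∫ ω, (falseRejCount c p I₀ (firstNulls I₀ j) ω : ℝ) ∂P =
      ((I₀.card - j : ℕ) : ℝ) * ∫ ω, c (substCount c p I₀ (j + 1) ω) ∂P := by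
    have := h.integral_choose_falseRejCount h.toIsCritical (k := 1) (firstNulls_subset I₀ j)
      (firstNulls_subset I₀ (j + 1)) (by rw [hcard hj, hcard hj.le]) fun _ => 1
    simpa only [substCount, Nat.choose_one_right, pow_one, mul_one, hcard hj.le] using this
  have hV : Integrable (fun ω => (falseRejCount c p I₀ (firstNulls I₀ j) ω : ℝ)) P :=
    h.integrable_falseRejCount_rejCount h.zero _ fun x => (x.1 : ℝ)
  have hR (i : ℕ) : Integrable (fun ω => (substCount c p I₀ i ω : ℝ)) P :=
    h.integrable_substCount h.zero i fun r => (r : ℝ)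
  have hreject : ∫ ω, (substCount c p I₀ j ω : ℝ) ∂P ≤
      ∫ ω, (falseRejCount c p I₀ (firstNulls I₀ j) ω : ℝ) ∂P + (I₀ᶜ.card + j) := by
    refine (integral_mono (hR j) (hV.add (integrable_const ((I₀ᶜ.card : ℝ) + j)))
      fun ω => ?_).trans_eq ?_
    · simpa only [substCount, hcard hj.le, Nat.cast_add, Pi.add_apply] using
        (Nat.cast_le (α := ℝ)).2 (rejCount_le_falseRejCount_add h.zero I₀ (firstNulls I₀ j) ω)
    · rw [integral_add' hV (integrable_const _), integral_const, probReal_univ, one_smul]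
  have hfalse : ((I₀.card - j : ℕ) : ℝ) * ∫ ω, c (substCount c p I₀ (j + 1) ω) ∂P ≤
      u * ∫ ω, (substCount c p I₀ (j + 1) ω : ℝ) ∂P := by
    rw [← integral_const_mul, ← integral_const_mul]
    refine integral_mono ((h.integrable_substCount h.zero _ c).const_mul _) ((hR _).const_mul _)
      fun ω => le_trans ?_ (h.apply_substCount_le j.succ_pos ω)
    exact mul_le_mul_of_nonneg_right (Nat.cast_le.2 (Nat.sub_le _ _))
      (h.apply_rejCount_mem_Icc _ ω).1
  rw [integral_div, integral_div, mul_div_assoc', ← add_div]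
  gcongr
  linarith

end RegularTest

section CriticalValues

variable {m : ℕ} {α a b : ℝ}

lemma AdmissibleParams.nonneg (hab : AdmissibleParams α a b) : 0 ≤ a :=
  hab.elim (·.2.1) (·.2.1)

lemma AdmissibleParams.le_one_sub (hab : AdmissibleParams α a b) : a ≤ 1 - α :=
  hab.elim (·.2.2) (·.2.2.le)

lemma AdmissibleParams.nonneg_right (hab : AdmissibleParams α a b) : 0 ≤ b :=
  hab.elim (·.1.le) (·.1.ge)

/-- The normalized denominator `(m + b - a r) / m₀` of the critical values. -/
noncomputable def normDenom (a b : ℝ) (m m₀ r : ℕ) : ℝ := (m + b - a * r) / m₀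

lemma AdmissibleParams.le_denom (hab : AdmissibleParams α a b) {r : ℕ} (hr : r ≤ m) :
    (1 - a) * m ≤ m + b - a * r := by
  have : a * r ≤ a * m := mul_le_mul_of_nonneg_left (Nat.cast_le.2 hr) hab.nonneg
  linarith [hab.nonneg_right]

lemma mul_critVal_div (m₀ : ℕ) {r : ℕ} (hr : 0 < r) :
    m₀ * critVal α a b m r / r = α / normDenom a b m m₀ r := by
  have hr' : (r : ℝ) ≠ 0 := Nat.cast_ne_zero.2 hr.ne'
  rw [critVal, normDenom, div_div_eq_mul_div, mul_div_assoc', div_right_comm]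
  congr 1
  field_simp

lemma critVal_div {r : ℕ} (hr : 0 < r) : critVal α a b m r / r = α / (m + b - a * r) := by
  simpa [normDenom] using mul_critVal_div (α := α) (a := a) (b := b) (m := m) 1 hr

lemma AdmissibleParams.isCritical_critVal (hab : AdmissibleParams α a b) (hα : 0 < α)
    (hm : 0 < m) : IsCritical m (critVal α a b m) where
  zero := by simp [critVal]
  mono i j hij hj := by
    have hden : 0 < m + b - a * j :=
      (mul_pos (hα.trans_le (by linarith [hab.le_one_sub])) (Nat.cast_pos.2 hm)).trans_le
        (hab.le_denom hj)
    unfold critVal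
    have := hab.nonneg
    gcongr
  le_one := by
    have hden := hab.le_denom (le_refl m)
    have : α * m ≤ (1 - a) * m := by gcongr; linarith [hab.le_one_sub]
    rw [critVal, mul_comm]
    exact div_le_one_of_le₀ (by linarith) (le_trans (by positivity) (this.trans hden))

variable {Ω : Type*} [MeasurableSpace Ω] {P : Measure Ω} {p : Fin m → Ω → ℝ} {I₀ : Finset (Fin m)}
  {l u : ℝ} {j : ℕ}

lemma AdmissibleParams.isRegularTest_critVal {A K : ℝ} (hab : AdmissibleParams α a b)
    (h : BasicIndependence P p I₀) (hα : 0 < α) (h2 : 2 ≤ I₀.card) (haA : a ≤ A) (hA : A < 1)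
    (hK : (m + b) / I₀.card ≤ K) :
    IsRegularTest P p I₀ (critVal α a b m) (α / K) (α / (1 - A)) := by
  have hm₀ : (0 : ℝ) < I₀.card := Nat.cast_pos.2 (two_pos.trans_le h2)
  have hm : (0 : ℝ) < m := hm₀.trans_le (Nat.cast_le.2 (card_nulls_le I₀))
  have hlow {r : ℕ} (hr : r ≤ m) : 1 - A ≤ normDenom a b m I₀.card r := by
    rw [normDenom, le_div_iff₀ hm₀]
    refine le_trans ?_ (hab.le_denom hr)
    exact mul_le_mul (by linarith) (Nat.cast_le.2 (card_nulls_le I₀)) hm₀.le (by linarith)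
  have hup (r : ℕ) : normDenom a b m I₀.card r ≤ K := by
    refine le_trans ?_ hK
    rw [normDenom]
    gcongr
    exact sub_le_self _ (mul_nonneg hab.nonneg (Nat.cast_nonneg _))
  have hK0 : 0 < K := by linarith [hlow le_rfl, hup m]
  refine ⟨h, hab.isCritical_critVal hα (Nat.cast_pos.1 hm), h2, div_pos hα hK0,
    fun r hr hrm => ?_, fun r s hr hrs hsm => ?_⟩
  · rw [mul_critVal_div _ hr]
    exact ⟨div_le_div_of_nonneg_left hα.le (by linarith [hlow hrm]) (hup r),
      div_le_div_of_nonneg_left hα.le (by linarith) (hlow hrm)⟩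
  · rw [critVal_div hr, critVal_div (hr.trans_le hrs)]
    have hden : 0 < m + b - a * s := (mul_pos (by linarith) hm).trans_le (hab.le_denom hsm)
    have := hab.nonneg
    gcongr

lemma IsRegularTest.nominalFDP_critVal (h : IsRegularTest P p I₀ (critVal α a b m) l u)
    (hj : 0 < j) (ω : Ω) :
    nominalFDP (critVal α a b m) p I₀ j ω =
      α / normDenom a b m I₀.card (substCount (critVal α a b m) p I₀ j ω) :=
  mul_critVal_div _ (h.substCount_pos h.toIsCritical hj ω)

lemma IsRegularTest.normDenom_eq (h : IsRegularTest P p I₀ (critVal α a b m) l u) (hα : 0 < α)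
    (hj : 0 < j) (ω : Ω) :
    normDenom a b m I₀.card (substCount (critVal α a b m) p I₀ j ω) =
      α / nominalFDP (critVal α a b m) p I₀ j ω := by
  rw [h.nominalFDP_critVal hj, div_div_cancel₀ hα.ne']

lemma IsRegularTest.normDenom_mem_Icc (h : IsRegularTest P p I₀ (critVal α a b m) l u)
    (hα : 0 < α) (hj : 0 < j) (ω : Ω) :
    normDenom a b m I₀.card (substCount (critVal α a b m) p I₀ j ω) ∈ Set.Icc (α / u) (α / l) := by
  obtain ⟨hl, hu⟩ := h.nominalFDP_mem_Icc hj ω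
  rw [h.normDenom_eq hα hj]
  exact ⟨div_le_div_of_nonneg_left hα.le (h.nominalFDP_pos hj ω) hu,
    div_le_div_of_nonneg_left hα.le h.lower_pos hl⟩

lemma IsRegularTest.increment_eq (h : IsRegularTest P p I₀ (critVal α a b m) l u) (hα : 0 < α)
    (ω : Ω) :
    a / m * ((substCount (critVal α a b m) p I₀ 2 ω : ℝ) - substCount (critVal α a b m) p I₀ 1 ω) =
      I₀.card / m * α *
        ((nominalFDP (critVal α a b m) p I₀ 1 ω)⁻¹ -
          (nominalFDP (critVal α a b m) p I₀ 2 ω)⁻¹) := by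
  have hm := h.pos
  have hm₀ := h.card_pos
  rw [mul_assoc, mul_sub α, ← div_eq_mul_inv, ← div_eq_mul_inv, ← h.normDenom_eq hα one_pos,
    ← h.normDenom_eq hα two_pos, normDenom, normDenom]
  field_simp
  ring

lemma inv_sub_inv_bounds {l u x y : ℝ} (hl : 0 < l) (hx : x ∈ Set.Icc l u) (hy : y ∈ Set.Icc l u)
    (hxy : x ≤ y) :
    (2 * u ^ 3)⁻¹ * (y ^ 2 - x ^ 2) ≤ x⁻¹ - y⁻¹ ∧
      x⁻¹ - y⁻¹ ≤ (2 * l ^ 3)⁻¹ * (y ^ 2 - x ^ 2) := by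
  have hx0 : 0 < x := hl.trans_le hx.1
  have hy0 : 0 < y := hl.trans_le hy.1
  have hfactor : x⁻¹ - y⁻¹ = (x * y * (x + y))⁻¹ * (y ^ 2 - x ^ 2) := by
    field_simp
    ring
  have hsq : 0 ≤ y ^ 2 - x ^ 2 := sub_nonneg.2 (pow_le_pow_left₀ hx0.le hxy 2)
  have hlow : 2 * l ^ 3 ≤ x * y * (x + y) :=
    calc 2 * l ^ 3 = l * l * (l + l) := by ring
      _ ≤ x * y * (x + y) := mul_le_mul (mul_le_mul hx.1 hy.1 hl.le hx0.le)
          (add_le_add hx.1 hy.1) (by positivity) (by positivity)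
  have hup : x * y * (x + y) ≤ 2 * u ^ 3 :=
    calc x * y * (x + y) ≤ u * u * (u + u) := mul_le_mul
          (mul_le_mul hx.2 hy.2 hy0.le (hx0.le.trans hx.2)) (add_le_add hx.2 hy.2) (by positivity)
          (mul_self_nonneg u)
      _ = 2 * u ^ 3 := by ring
  rw [hfactor]
  exact ⟨mul_le_mul_of_nonneg_right (inv_anti₀ (by positivity) hup) hsq,
    mul_le_mul_of_nonneg_right (inv_anti₀ (by positivity) hlow) hsq⟩

lemma IsRegularTest.increment_bounds (h : IsRegularTest P p I₀ (critVal α a b m) l u) (hα : 0 < α)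
    (ω : Ω) :
    l * α * (2 * u ^ 3)⁻¹ *
        (nominalFDP (critVal α a b m) p I₀ 2 ω ^ 2 - nominalFDP (critVal α a b m) p I₀ 1 ω ^ 2) ≤
      a / m * ((substCount (critVal α a b m) p I₀ 2 ω : ℝ) -
        substCount (critVal α a b m) p I₀ 1 ω) ∧
    a / m * ((substCount (critVal α a b m) p I₀ 2 ω : ℝ) -
        substCount (critVal α a b m) p I₀ 1 ω) ≤
      α * (2 * l ^ 3)⁻¹ *
        (nominalFDP (critVal α a b m) p I₀ 2 ω ^ 2 -
          nominalFDP (critVal α a b m) p I₀ 1 ω ^ 2) := by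
  have hmono := h.nominalFDP_one_le_two ω
  obtain ⟨hlow, hup⟩ := inv_sub_inv_bounds h.lower_pos (h.nominalFDP_mem_Icc one_pos ω)
    (h.nominalFDP_mem_Icc two_pos ω) hmono
  have hnonneg := sub_nonneg.2 (inv_anti₀ (h.nominalFDP_pos one_pos ω) hmono)
  have hl := h.lower_pos
  rw [h.increment_eq hα, mul_assoc (l * α), mul_assoc α]
  constructor
  · refine mul_le_mul_of_nonneg_left hlow (by positivity) |>.trans ?_
    exact mul_le_mul_of_nonneg_right (mul_le_mul_of_nonneg_right h.le_card_div hα.le) hnonneg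
  · refine le_trans ?_ (mul_le_mul_of_nonneg_left hup hα.le)
    exact mul_le_mul_of_nonneg_right
      (mul_le_of_le_one_left hα.le (card_nulls_div_le_one I₀)) hnonneg

lemma IsRegularTest.increment_mem_Icc (h : IsRegularTest P p I₀ (critVal α a b m) l u) (hα : 0 < α)
    (ω : Ω) :
    a / m * ((substCount (critVal α a b m) p I₀ 2 ω : ℝ) - substCount (critVal α a b m) p I₀ 1 ω) ∈
      Set.Icc 0 (α * (2 * l ^ 3)⁻¹ * u ^ 2) := by
  have hl := h.lower_pos
  have hu := h.upper_pos
  obtain ⟨hlow, hup⟩ := h.increment_bounds hα ω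
  refine ⟨(mul_nonneg (by positivity) (h.nominalFDP_sq_sub_nonneg ω)).trans hlow, hup.trans ?_⟩
  refine mul_le_mul_of_nonneg_left ((sub_le_self _ (sq_nonneg _)).trans ?_) (by positivity)
  exact pow_le_pow_left₀ (h.nominalFDP_pos two_pos ω).le (h.nominalFDP_mem_Icc two_pos ω).2 2

lemma IsRegularTest.measurable_increment (h : IsRegularTest P p I₀ (critVal α a b m) l u) :
    Measurable fun ω => a / m * ((substCount (critVal α a b m) p I₀ 2 ω : ℝ) -
      substCount (critVal α a b m) p I₀ 1 ω) :=
  have hmeas (j : ℕ) := h.measurable_substCount h.zero j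
  ((Measurable.of_discrete.comp (hmeas 2)).sub (Measurable.of_discrete.comp (hmeas 1))).const_mul _

lemma IsRegularTest.abs_normDenom_sub_one_le
    (h : IsRegularTest P p I₀ (critVal α a b m) l u) (ha : a ∈ Set.Icc 0 1) (r : ℕ) :
    |normDenom a b m I₀.card r - 1| ≤ |(m + b) / I₀.card - 1| + l⁻¹ * (r / m : ℝ) := by
  have hm := h.pos
  have hm₀ := h.card_pos
  have hsplit : normDenom a b m I₀.card r - 1 =
      ((m + b) / I₀.card - 1) - (I₀.card / m : ℝ)⁻¹ * (a * (r / m)) := by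
    rw [normDenom]
    field_simp
    ring
  have hr : (0 : ℝ) ≤ r / m := by positivity
  have hratio : (I₀.card / m : ℝ)⁻¹ ≤ l⁻¹ := inv_anti₀ h.lower_pos h.le_card_div
  rw [hsplit]
  refine (abs_sub _ _).trans ?_
  rw [abs_of_nonneg (a := _ * _) (mul_nonneg (by positivity) (mul_nonneg ha.1 hr))]
  exact add_le_add_right (mul_le_mul hratio (mul_le_of_le_one_left hr ha.2)
    (mul_nonneg ha.1 hr) (inv_nonneg.2 h.lower_pos.le)) _

lemma abs_div_sub_div_le {α s x y : ℝ} (hα : 0 ≤ α) (hs : 0 < s) (hx : s ≤ x) (hy : s ≤ y) :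
    |α / x - α / y| ≤ α / s ^ 2 * |x - y| := by
  have hx0 := hs.trans_le hx
  have hy0 := hs.trans_le hy
  have heq : α / x - α / y = α / (x * y) * (y - x) := by field_simp
  rw [heq, abs_mul, abs_sub_comm, abs_of_nonneg (by positivity), sq]
  gcongr

variable [IsProbabilityMeasure P]

lemma IsRegularTest.integrable_normDenom (h : IsRegularTest P p I₀ (critVal α a b m) l u) (j : ℕ)
    (g : ℝ → ℝ) : Integrable (fun ω =>
      g (normDenom a b m I₀.card (substCount (critVal α a b m) p I₀ j ω))) P :=
  h.integrable_substCount h.zero j fun r => g (normDenom a b m I₀.card r)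

lemma IsRegularTest.integrable_increment (h : IsRegularTest P p I₀ (critVal α a b m) l u) :
    Integrable (fun ω => a / m * ((substCount (critVal α a b m) p I₀ 2 ω : ℝ) -
      substCount (critVal α a b m) p I₀ 1 ω)) P :=
  have hint (j : ℕ) := h.integrable_substCount h.zero j (fun r => (r : ℝ))
  ((hint 2).sub (hint 1)).const_mul _

lemma IsRegularTest.variance_nominalFDP_bounds (h : IsRegularTest P p I₀ (critVal α a b m) l u)
    (hα : 0 < α) (hj : 0 < j) :
    let ζ := fun ω => normDenom a b m I₀.card (substCount (critVal α a b m) p I₀ j ω)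
    Var[nominalFDP (critVal α a b m) p I₀ j; P] ≤ (α / (α / u) ^ 2) ^ 2 * Var[ζ; P] ∧
      Var[ζ; P] ≤ (α / l ^ 2) ^ 2 * Var[nominalFDP (critVal α a b m) p I₀ j; P] := by
  intro ζ
  have hq := memLp_two_of_forall_integrable (h.integrable_nominalFDP h.zero j)
  have hζ := memLp_two_of_forall_integrable (h.integrable_normDenom j)
  constructor
  · refine variance_le_of_abs_sub_le hζ hq fun ω ω' => ?_
    rw [h.nominalFDP_critVal hj, h.nominalFDP_critVal hj]
    exact abs_div_sub_div_le hα.le (div_pos hα h.upper_pos) (h.normDenom_mem_Icc hα hj ω).1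
      (h.normDenom_mem_Icc hα hj ω').1
  · refine variance_le_of_abs_sub_le hq hζ fun ω ω' => ?_
    simp only [ζ, h.normDenom_eq hα hj]
    exact abs_div_sub_div_le hα.le h.lower_pos (h.nominalFDP_mem_Icc hj ω).1
      (h.nominalFDP_mem_Icc hj ω').1

lemma IsRegularTest.integral_abs_nominalFDP_sub_le
    (h : IsRegularTest P p I₀ (critVal α a b m) l u) (hα : 0 < α)
    (ha : a ∈ Set.Icc 0 1) (hj : 0 < j) :
    ∫ ω, |nominalFDP (critVal α a b m) p I₀ j ω - α| ∂P ≤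
      u * (|(m + b) / I₀.card - 1| +
        l⁻¹ * ∫ ω, (substCount (critVal α a b m) p I₀ j ω / m : ℝ) ∂P) := by
  have hu := h.upper_pos
  have hint : Integrable (fun ω => (substCount (critVal α a b m) p I₀ j ω / m : ℝ)) P :=
    h.integrable_substCount h.zero j fun r => r / m
  have hpt (ω : Ω) : |nominalFDP (critVal α a b m) p I₀ j ω - α| ≤
      u * (|(m + b) / I₀.card - 1| +
        l⁻¹ * (substCount (critVal α a b m) p I₀ j ω / m : ℝ)) := by
    have hζ := (div_pos hα hu).trans_le (h.normDenom_mem_Icc hα hj ω).1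
    have hfactor : nominalFDP (critVal α a b m) p I₀ j ω - α =
        nominalFDP (critVal α a b m) p I₀ j ω *
          (1 - normDenom a b m I₀.card (substCount (critVal α a b m) p I₀ j ω)) := by
      rw [h.nominalFDP_critVal hj]
      field_simp
    rw [hfactor, abs_mul, abs_sub_comm, abs_of_pos (h.nominalFDP_pos hj ω)]
    exact mul_le_mul (h.nominalFDP_mem_Icc hj ω).2 (h.abs_normDenom_sub_one_le ha _)
      (abs_nonneg _) hu.le
  refine (integral_mono (h.integrable_nominalFDP h.zero j fun x => |x - α|)
    (((integrable_const _).add (hint.const_mul _)).const_mul _) hpt).trans_eq ?_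
  rw [integral_const_mul, integral_add' (integrable_const _) (hint.const_mul _), integral_const,
    integral_const_mul, probReal_univ, one_smul]

end CriticalValues

section Asymptotics

variable {Ω : ℕ → Type*} [∀ m, MeasurableSpace (Ω m)] {P : ∀ m, Measure (Ω m)}
  {p : ∀ m, Fin m → Ω m → ℝ} {I₀ : ∀ m, Finset (Fin m)} {c : ℕ → ℕ → ℝ} {α β κ₀ l u : ℝ}
  {a b : ℕ → ℝ}

lemma tendsto_card_nulls (hκ : 0 < κ₀)
    (hI₀ : Tendsto (fun m => ((I₀ m).card / m : ℝ)) atTop (𝓝 κ₀)) :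
    Tendsto (fun m => ((I₀ m).card : ℝ)) atTop atTop := by
  refine (hI₀.pos_mul_atTop hκ tendsto_natCast_atTop_atTop).congr' ?_
  filter_upwards [eventually_ne_atTop 0] with m hm
  exact div_mul_cancel₀ _ (Nat.cast_ne_zero.2 hm)

lemma tendsto_card_compl_div
    (hI₀ : Tendsto (fun m => ((I₀ m).card / m : ℝ)) atTop (𝓝 1)) :
    Tendsto (fun m => ((I₀ m)ᶜ.card / m : ℝ)) atTop (𝓝 0) := by
  have hsub := hI₀.const_sub 1
  rw [sub_self] at hsub
  refine hsub.congr' ?_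
  filter_upwards [eventually_ne_atTop 0] with m hm
  rw [Finset.card_compl, Fintype.card_fin, Nat.cast_sub (card_nulls_le _), sub_div,
    div_self (Nat.cast_ne_zero.2 hm)]

lemma tendsto_add_div_card_nulls (hκ : 0 < κ₀)
    (hI₀ : Tendsto (fun m => ((I₀ m).card / m : ℝ)) atTop (𝓝 κ₀))
    (hb : Tendsto (fun m => b m / m) atTop (𝓝 0)) :
    Tendsto (fun m => (m + b m) / (I₀ m).card) atTop (𝓝 κ₀⁻¹) := by
  have hdiv := (hb.const_add 1).div hI₀ hκ.ne'
  rw [add_zero, one_div] at hdiv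
  refine hdiv.congr' ?_
  filter_upwards [eventually_ne_atTop 0] with m hm
  have : (m : ℝ) ≠ 0 := Nat.cast_ne_zero.2 hm
  simp only [Pi.div_apply]
  field_simp

lemma eventually_isRegularTest_critVal
    (hBI : ∀ᶠ m in atTop, BasicIndependence (P m) (p m) (I₀ m)) (hα : 0 < α)
    (hab : ∀ᶠ m in atTop, AdmissibleParams α (a m) (b m)) (hκ : 0 < κ₀)
    (hI₀ : Tendsto (fun m => ((I₀ m).card / m : ℝ)) atTop (𝓝 κ₀))
    (hb : Tendsto (fun m => b m / m) atTop (𝓝 0)) {A : ℝ} (haA : ∀ᶠ m in atTop, a m ≤ A)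
    (hA : A < 1) :
    ∀ᶠ m in atTop, IsRegularTest (P m) (p m) (I₀ m) (critVal α (a m) (b m) m)
      (α / (κ₀⁻¹ + 1)) (α / (1 - A)) := by
  filter_upwards [hBI, hab, haA, (tendsto_card_nulls hκ hI₀).eventually_ge_atTop 2,
    (tendsto_add_div_card_nulls hκ hI₀ hb).eventually_le_const (lt_add_one κ₀⁻¹)]
    with m hBIm habm haAm h2 hK
  exact habm.isRegularTest_critVal hBIm hα (Nat.ofNat_le_cast.1 h2) haAm hA hK

variable [∀ m, IsProbabilityMeasure (P m)]

lemma tendsto_variance_fdp_iff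
    (hT : ∀ᶠ m in atTop, IsRegularTest (P m) (p m) (I₀ m) (c m) l u)
    (hI₀ : Tendsto (fun m => ((I₀ m).card : ℝ)) atTop atTop) :
    Tendsto (fun m => Var[fun ω => fdp (c m) (I₀ m) fun i => p m i ω; P m]) atTop (𝓝 0) ↔
      Tendsto (fun m => ∫ ω, (substCount (c m) (p m) (I₀ m) 1 ω : ℝ)⁻¹ ∂P m) atTop (𝓝 0) ∧
      Tendsto (fun m => ∫ ω, (nominalFDP (c m) (p m) (I₀ m) 2 ω ^ 2 -
        nominalFDP (c m) (p m) (I₀ m) 1 ω ^ 2) ∂P m) atTop (𝓝 0) ∧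
      Tendsto (fun m => Var[nominalFDP (c m) (p m) (I₀ m) 1; P m]) atTop (𝓝 0) := by
  obtain ⟨m₁, hm₁⟩ := hT.exists
  have hremainder : Tendsto (fun m => ((I₀ m).card : ℝ)⁻¹ *
      ∫ ω, nominalFDP (c m) (p m) (I₀ m) 2 ω ^ 2 ∂P m) atTop (𝓝 0) := by
    refine squeeze_zero' (.of_forall fun m => by positivity) (hT.mono fun m hm => ?_)
      (by simpa using (tendsto_inv_atTop_zero.comp hI₀).mul_const (u ^ 2))
    exact mul_le_mul_of_nonneg_left (hm.integral_nominalFDP_sq_le two_pos) (by positivity)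
  have hsplit : (fun m => Var[fun ω => fdp (c m) (I₀ m) fun i => p m i ω; P m]) =ᶠ[atTop] fun m =>
      (∫ ω, nominalFDP (c m) (p m) (I₀ m) 1 ω / substCount (c m) (p m) (I₀ m) 1 ω ∂P m +
        (∫ ω, (nominalFDP (c m) (p m) (I₀ m) 2 ω ^ 2 - nominalFDP (c m) (p m) (I₀ m) 1 ω ^ 2) ∂P m +
          Var[nominalFDP (c m) (p m) (I₀ m) 1; P m])) -
      ((I₀ m).card : ℝ)⁻¹ * ∫ ω, nominalFDP (c m) (p m) (I₀ m) 2 ω ^ 2 ∂P m := by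
    filter_upwards [hT] with m hm
    rw [hm.variance_fdp hm.toIsCritical hm.two_le_card, ← add_assoc]
  have hinv : ∀ᶠ m in atTop, 0 ≤ ∫ ω, (substCount (c m) (p m) (I₀ m) 1 ω : ℝ)⁻¹ ∂P m :=
    .of_forall fun m => integral_nonneg fun ω => by positivity
  have hquot : ∀ᶠ m in atTop, 0 ≤
      ∫ ω, nominalFDP (c m) (p m) (I₀ m) 1 ω / substCount (c m) (p m) (I₀ m) 1 ω ∂P m :=
    hT.mono fun m hm => integral_nonneg fun ω =>
      div_nonneg (hm.nominalFDP_pos one_pos ω).le (Nat.cast_nonneg _)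
  have hincr : ∀ᶠ m in atTop, 0 ≤ ∫ ω, (nominalFDP (c m) (p m) (I₀ m) 2 ω ^ 2 -
      nominalFDP (c m) (p m) (I₀ m) 1 ω ^ 2) ∂P m :=
    hT.mono fun m hm => integral_nonneg fun ω => hm.nominalFDP_sq_sub_nonneg ω
  have hvar : ∀ᶠ m in atTop, 0 ≤ Var[nominalFDP (c m) (p m) (I₀ m) 1; P m] :=
    .of_forall fun m => variance_nonneg _ _
  rw [← tendsto_zero_iff_of_le_of_le hm₁.lower_pos hinv
      (hT.mono fun _ hm => hm.integral_nominalFDP_div_substCount_bounds.1)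
      (hT.mono fun _ hm => hm.integral_nominalFDP_div_substCount_bounds.2),
    ← tendsto_add_zero_iff_of_nonneg hincr hvar,
    ← tendsto_add_zero_iff_of_nonneg hquot (by
      filter_upwards [hincr, hvar] with m using add_nonneg), tendsto_congr' hsplit]
  exact ⟨fun h => by simpa using h.add hremainder, fun h => by simpa using h.sub hremainder⟩

lemma tendstoInProb_fdp_iff
    (hT : ∀ᶠ m in atTop, IsRegularTest (P m) (p m) (I₀ m) (c m) l u)
    (hI₀ : Tendsto (fun m => ((I₀ m).card : ℝ)) atTop atTop) :
    TendstoInProb P (fun m ω => fdp (c m) (I₀ m) (fun i => p m i ω) -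
        ∫ ω', fdp (c m) (I₀ m) (fun i => p m i ω') ∂P m) 0 ↔
      TendstoInProbAtTop P (fun m ω => (substCount (c m) (p m) (I₀ m) 1 ω : ℝ)) ∧
      Tendsto (fun m => ∫ ω, (nominalFDP (c m) (p m) (I₀ m) 2 ω ^ 2 -
        nominalFDP (c m) (p m) (I₀ m) 1 ω ^ 2) ∂P m) atTop (𝓝 0) ∧
      Tendsto (fun m => Var[nominalFDP (c m) (p m) (I₀ m) 1; P m]) atTop (𝓝 0) := by
  rw [tendstoInProb_sub_integral_iff_variance (C := 1) (hT.mono fun m hm =>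
      ⟨hm.measurable_fdp hm.zero, hm.fdp_mem_Icc (I₀ m)⟩),
    tendsto_variance_fdp_iff hT hI₀, tendstoInProbAtTop_iff_integral_inv (hT.mono fun m hm =>
      ⟨hm.measurable_substCount hm.zero 1, hm.substCount_pos hm.toIsCritical one_pos⟩)]

lemma tendstoInProb_increment_iff
    (hT : ∀ᶠ m in atTop, IsRegularTest (P m) (p m) (I₀ m) (critVal α (a m) (b m) m) l u)
    (hα : 0 < α) :
    TendstoInProb P (fun m ω => a m / m *
        ((substCount (critVal α (a m) (b m) m) (p m) (I₀ m) 2 ω : ℝ) -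
          substCount (critVal α (a m) (b m) m) (p m) (I₀ m) 1 ω)) 0 ↔
      Tendsto (fun m => ∫ ω, (nominalFDP (critVal α (a m) (b m) m) (p m) (I₀ m) 2 ω ^ 2 -
        nominalFDP (critVal α (a m) (b m) m) (p m) (I₀ m) 1 ω ^ 2) ∂P m) atTop (𝓝 0) := by
  obtain ⟨m₁, hm₁⟩ := hT.exists
  have hl := hm₁.lower_pos
  have hu := hm₁.upper_pos
  rw [tendstoInProb_zero_iff_integral (hT.mono fun m hm =>
    ⟨hm.measurable_increment, hm.increment_mem_Icc hα⟩)]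
  refine tendsto_zero_iff_of_le_of_le (k := l * α * (2 * u ^ 3)⁻¹) (K := α * (2 * l ^ 3)⁻¹)
    (by positivity) (hT.mono fun _ hm => integral_nonneg hm.nominalFDP_sq_sub_nonneg)
    (hT.mono fun m hm => ?_) (hT.mono fun m hm => ?_)
  all_goals rw [← integral_const_mul]
  · exact integral_mono (hm.integrable_nominalFDP_sq_sub.const_mul _) hm.integrable_increment
      fun ω => (hm.increment_bounds hα ω).1
  · exact integral_mono hm.integrable_increment (hm.integrable_nominalFDP_sq_sub.const_mul _)
      fun ω => (hm.increment_bounds hα ω).2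

lemma tendstoInProb_normDenom_sub_integral_iff
    (hT : ∀ᶠ m in atTop, IsRegularTest (P m) (p m) (I₀ m) (critVal α (a m) (b m) m) l u)
    (hα : 0 < α) {j : ℕ} (hj : 0 < j) {ζ : ∀ m, Ω m → ℝ}
    (hζ : ζ = fun m ω => normDenom (a m) (b m) m (I₀ m).card
      (substCount (critVal α (a m) (b m) m) (p m) (I₀ m) j ω)) :
    TendstoInProb P (fun m ω => ζ m ω - ∫ ω', ζ m ω' ∂P m) 0 ↔
      Tendsto (fun m => Var[nominalFDP (critVal α (a m) (b m) m) (p m) (I₀ m) j; P m])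
        atTop (𝓝 0) := by
  subst hζ
  obtain ⟨m₁, hm₁⟩ := hT.exists
  have hu := hm₁.upper_pos
  rw [tendstoInProb_sub_integral_iff_variance (C := α / l) (hT.mono fun m hm => ⟨?_, fun ω => ?_⟩)]
  · refine tendsto_zero_iff_of_le_of_le (k := ((α / (α / u) ^ 2) ^ 2)⁻¹) (by positivity)
      (.of_forall fun m => variance_nonneg _ _) (hT.mono fun m hm => ?_)
      (hT.mono fun m hm => (hm.variance_nominalFDP_bounds hα hj).2)
    exact (inv_mul_le_iff₀ (by positivity)).2 (hm.variance_nominalFDP_bounds hα hj).1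
  · exact (Measurable.of_discrete (f := normDenom (a m) (b m) m (I₀ m).card)).comp
      (hm.measurable_substCount hm.zero j)
  · exact Set.Icc_subset_Icc_left (by positivity) (hm.normDenom_mem_Icc hα hj ω)

lemma tendsto_integral_substCount_div
    (hT : ∀ᶠ m in atTop, IsRegularTest (P m) (p m) (I₀ m) (c m) l u) (hu : u < 1)
    (hI₀ : Tendsto (fun m => ((I₀ m).card / m : ℝ)) atTop (𝓝 1)) (j : ℕ) :
    Tendsto (fun m => ∫ ω, (substCount (c m) (p m) (I₀ m) j ω / m : ℝ) ∂P m) atTop (𝓝 0) := by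
  obtain ⟨m₁, hm₁⟩ := hT.exists
  refine tendsto_zero_of_le_mul_succ_add (u := u)
    (x := fun j m => ∫ ω, (substCount (c m) (p m) (I₀ m) j ω / m : ℝ) ∂P m)
    (e := fun j m => ((I₀ m)ᶜ.card + j) / m) hm₁.upper_pos.le hu
    (fun j => .of_forall fun m => integral_nonneg fun ω => by positivity)
    (fun j => hT.mono fun m hm => ?_) (fun j => ?_) (fun j => ?_) j
  · have hint := hm.integrable_substCount hm.zero j fun r => (r / m : ℝ)
    simpa using integral_mono hint (integrable_const 1) fun ω => div_le_one_of_le₀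
      (Nat.cast_le.2 (numRejections_le hm.zero _)) (Nat.cast_nonneg _)
  · simpa only [add_div, add_zero] using
      (tendsto_card_compl_div hI₀).add (tendsto_const_div_atTop_nhds_zero_nat (j : ℝ))
  · filter_upwards [hT, (tendsto_card_nulls one_pos hI₀).eventually_gt_atTop (j : ℝ)] with m hm hj
    exact hm.integral_substCount_div_le (Nat.cast_lt.1 hj)

lemma tendsto_integral_abs_nominalFDP_sub
    (hT : ∀ᶠ m in atTop, IsRegularTest (P m) (p m) (I₀ m) (critVal α (a m) (b m) m) l u)
    (hu : u < 1) (hα : 0 < α) (ha : ∀ᶠ m in atTop, a m ∈ Set.Icc 0 1)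
    (hI₀ : Tendsto (fun m => ((I₀ m).card / m : ℝ)) atTop (𝓝 1))
    (hb : Tendsto (fun m => b m / m) atTop (𝓝 0)) {j : ℕ} (hj : 0 < j) :
    Tendsto (fun m => ∫ ω, |nominalFDP (critVal α (a m) (b m) m) (p m) (I₀ m) j ω - α| ∂P m)
      atTop (𝓝 0) := by
  have hratio := ((tendsto_add_div_card_nulls one_pos hI₀ hb).sub_const 1).abs
  rw [inv_one, sub_self, abs_zero] at hratio
  have hbound := (hratio.add
    ((tendsto_integral_substCount_div hT hu hI₀ j).const_mul l⁻¹)).const_mul u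
  rw [mul_zero, add_zero, mul_zero] at hbound
  refine squeeze_zero' (.of_forall fun m => integral_nonneg fun ω => abs_nonneg _) ?_ hbound
  filter_upwards [hT, ha] with m hm ham
  exact hm.integral_abs_nominalFDP_sub_le hα ham hj

lemma tendsto_integral_fdp
    (hT : ∀ᶠ m in atTop, IsRegularTest (P m) (p m) (I₀ m) (c m) l u)
    (hq : Tendsto (fun m => ∫ ω, |nominalFDP (c m) (p m) (I₀ m) 1 ω - β| ∂P m) atTop (𝓝 0)) :
    Tendsto (fun m => ∫ ω, fdp (c m) (I₀ m) (fun i => p m i ω) ∂P m) atTop (𝓝 β) :=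
  tendsto_iff_norm_sub_tendsto_zero.2 <| squeeze_zero' (.of_forall fun _ => norm_nonneg _)
    (hT.mono fun _ hm => hm.abs_integral_fdp_sub_le β) hq

lemma tendsto_variance_nominalFDP
    (hT : ∀ᶠ m in atTop, IsRegularTest (P m) (p m) (I₀ m) (c m) l u) {j : ℕ} (hj : 0 < j)
    (hq : Tendsto (fun m => ∫ ω, |nominalFDP (c m) (p m) (I₀ m) j ω - β| ∂P m) atTop (𝓝 0)) :
    Tendsto (fun m => Var[nominalFDP (c m) (p m) (I₀ m) j; P m]) atTop (𝓝 0) :=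
  squeeze_zero' (.of_forall fun _ => variance_nonneg _ _)
    (hT.mono fun _ hm => hm.variance_nominalFDP_le hj β) (by simpa using hq.const_mul (u + |β|))

lemma tendsto_integral_nominalFDP_sq_sub
    (hT : ∀ᶠ m in atTop, IsRegularTest (P m) (p m) (I₀ m) (c m) l u)
    (hq : ∀ j, 0 < j →
      Tendsto (fun m => ∫ ω, |nominalFDP (c m) (p m) (I₀ m) j ω - β| ∂P m) atTop (𝓝 0)) :
    Tendsto (fun m => ∫ ω, (nominalFDP (c m) (p m) (I₀ m) 2 ω ^ 2 -
      nominalFDP (c m) (p m) (I₀ m) 1 ω ^ 2) ∂P m) atTop (𝓝 0) :=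
  squeeze_zero' (hT.mono fun _ hm => integral_nonneg hm.nominalFDP_sq_sub_nonneg)
    (hT.mono fun _ hm => hm.integral_nominalFDP_sq_sub_le β)
    (by simpa using ((hq 2 two_pos).add (hq 1 one_pos)).const_mul (2 * u))

end Asymptotics

end StepUp

theorem lemma5p6_general {Ω : ℕ → Type*} [∀ m, MeasurableSpace (Ω m)]
    (P : ∀ m, Measure (Ω m)) [∀ m, IsProbabilityMeasure (P m)]
    (p : ∀ m, Fin m → Ω m → ℝ) (I₀ : ∀ m, Finset (Fin m))
    (hBI : ∀ᶠ m in atTop, StepUp.BasicIndependence (P m) (p m) (I₀ m))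
    (α : ℝ) (hα : 0 < α)
    (κ₀ : ℝ) (hκ : 0 < κ₀)
    (hI₀ : Tendsto (fun m : ℕ => ((I₀ m).card : ℝ) / (m : ℝ)) atTop (𝓝 κ₀))
    (a b : ℕ → ℝ)
    (hb : Tendsto (fun m : ℕ => b m / (m : ℝ)) atTop (𝓝 0))
    (hab : ∀ᶠ m in atTop, StepUp.AdmissibleParams α (a m) (b m))
    (FDP : ∀ m, Ω m → ℝ)
    (hFDP : FDP = fun m ω => StepUp.fdp (StepUp.critVal α (a m) (b m) m) (I₀ m) fun i => p m i ω)
    (R : ℕ → ∀ m, Ω m → ℝ)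
    (hR : R = fun j m ω => (StepUp.numRejectionsSubst (StepUp.critVal α (a m) (b m) m) (I₀ m) j
      fun i => p m i ω : ℝ))
    (ζ : ∀ m, Ω m → ℝ)
    (hζ : ζ = fun (m : ℕ) ω => ((m : ℝ) + b m - a m * R 1 m ω) / ((I₀ m).card : ℝ)) :
    (StepUp.TendstoInProb P (fun m ω => FDP m ω - ∫ ω', FDP m ω' ∂(P m)) 0 ↔
      StepUp.TendstoInProbAtTop P (R 1) ∧
      StepUp.TendstoInProb P (fun m ω => a m / (m : ℝ) * (R 2 m ω - R 1 m ω)) 0 ∧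
      StepUp.TendstoInProb P (fun m ω => ζ m ω - ∫ ω', ζ m ω' ∂(P m)) 0) ∧
    (κ₀ = 1 → limsup a atTop < 1 - α →
      (StepUp.TendstoInProbAtTop P (R 1) →
        StepUp.TendstoInProb P (fun m ω => FDP m ω - ∫ ω', FDP m ω' ∂(P m)) 0) ∧
      Tendsto (fun m : ℕ => ∫ ω, FDP m ω ∂(P m)) atTop (𝓝 α)) := by
  open StepUp in
  subst hFDP hR hζ
  simp only [numRejectionsSubst_eq_substCount]
  have hcard := tendsto_card_nulls hκ hI₀
  refine ⟨?_, ?_⟩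
  · have hT := eventually_isRegularTest_critVal hBI hα hab hκ hI₀ hb
      (hab.mono fun _ h => h.le_one_sub) (sub_lt_self 1 hα)
    exact (tendstoInProb_fdp_iff hT hcard).trans <| and_congr_right' <| and_congr
      (tendstoInProb_increment_iff hT hα).symm
      (tendstoInProb_normDenom_sub_integral_iff hT hα one_pos rfl).symm
  · rintro rfl hlimsup
    obtain ⟨A, haA, hA⟩ := exists_between hlimsup
    have ha : ∀ᶠ m in atTop, a m < A := eventually_lt_of_limsup_lt haA
      ⟨1 - α, eventually_map.2 (hab.mono fun _ h => h.le_one_sub)⟩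
    have hT := eventually_isRegularTest_critVal hBI hα hab hκ hI₀ hb
      (ha.mono fun _ => le_of_lt) (hA.trans (sub_lt_self 1 hα))
    have hq (j : ℕ) (hj : 0 < j) := tendsto_integral_abs_nominalFDP_sub hT
      ((div_lt_one (by linarith)).2 (by linarith)) hα (hab.mono fun _ h =>
        ⟨h.nonneg, h.le_one_sub.trans (sub_le_self 1 hα.le)⟩) hI₀ hb hj
    exact ⟨fun hR => (tendstoInProb_fdp_iff hT hcard).2 ⟨hR,
      tendsto_integral_nominalFDP_sq_sub hT hq,
      tendsto_variance_nominalFDP hT one_pos (hq 1 one_pos)⟩,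
      tendsto_integral_fdp hT (hq 1 one_pos)⟩

theorem lemma5p6 {Ω : ℕ → Type*} [∀ m, MeasurableSpace (Ω m)]
    (P : ∀ m, Measure (Ω m)) [∀ m, IsProbabilityMeasure (P m)]
    (p : ∀ m, Fin m → Ω m → ℝ) (I₀ : ∀ m, Finset (Fin m))
    (hBI : ∀ m, 2 ≤ m → StepUp.BasicIndependence (P m) (p m) (I₀ m))
    (α : ℝ) (hα0 : 0 < α) (hα1 : α < 1)
    (κ₀ : ℝ) (hκ : κ₀ ∈ Set.Ioc (0 : ℝ) 1)
    (hA1 : Tendsto (fun m : ℕ => ((I₀ m).card : ℝ) / (m : ℝ)) atTop (𝓝 κ₀))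
    (a b : ℕ → ℝ)
    (hb : Tendsto (fun m : ℕ => b m / (m : ℝ)) atTop (𝓝 0))
    (hab : ∀ m, 2 ≤ m → StepUp.AdmissibleParams α (a m) (b m))
    (FDP : ∀ m, Ω m → ℝ)
    (hFDP : FDP = fun m ω => StepUp.fdp (StepUp.critVal α (a m) (b m) m) (I₀ m) fun i => p m i ω)
    (R : ℕ → ∀ m, Ω m → ℝ)
    (hR : R = fun j m ω => (StepUp.numRejectionsSubst (StepUp.critVal α (a m) (b m) m) (I₀ m) j
      fun i => p m i ω : ℝ))
    (ζ : ∀ m, Ω m → ℝ)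
    (hζ : ζ = fun (m : ℕ) ω => ((m : ℝ) + b m - a m * R 1 m ω) / ((I₀ m).card : ℝ)) :
    (StepUp.TendstoInProb P (fun m ω => FDP m ω - ∫ ω', FDP m ω' ∂(P m)) 0 ↔
      StepUp.TendstoInProbAtTop P (R 1) ∧
      StepUp.TendstoInProb P (fun m ω => a m / (m : ℝ) * (R 2 m ω - R 1 m ω)) 0 ∧
      StepUp.TendstoInProb P (fun m ω => ζ m ω - ∫ ω', ζ m ω' ∂(P m)) 0) ∧
    (κ₀ = 1 → Tendsto (fun m : ℕ => (I₀ m)ᶜ.card) atTop atTop → limsup a atTop < 1 - α →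
      (StepUp.TendstoInProbAtTop P (R 1) →
        StepUp.TendstoInProb P (fun m ω => FDP m ω - ∫ ω', FDP m ω' ∂(P m)) 0) ∧
      Tendsto (fun m : ℕ => ∫ ω, FDP m ω ∂(P m)) atTop (𝓝 α)) :=
  (lemma5p6_general P p I₀ (eventually_atTop.2 ⟨2, hBI⟩) α hα0 κ₀ hκ.1 hA1 a b hb
    (eventually_atTop.2 ⟨2, hab⟩) FDP hFDP R hR ζ hζ).imp_right fun h hκ₁ _ => h hκ₁
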